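/- **Setting.** Let $p$ be a prime number, $K$ a complete discretely valued field of characteristic $0$ whose residue field is an algebraic closure of $\mathbb F_p$, with valuation ring $\mathcal O_K$, and let $\overline K$ be an algebraic closure of $K$. Let $\mathfrak o$ be the $p$-adic completion of the integral closure of $\mathcal O_K$ in $\overline K$, and let $\mathfrak m$ be its maximal ideal; one has $\mathfrak m^2=\mathfrak m$. Let $T$ be a topos (the category of sheaves on a small site). An $\mathfrak o$-module of $T$ is called $\alpha$-null if it is annihilated by $\mathfrak m$. The $\alpha$-null modules form a Serre subcategory of the abelian category of $\mathfrak o$-modules of $T$; let $\alpha\text{-}T$ be the quotient category, $X\mapsto X^\alpha$ the quotient functor, and equip $\alpha\text{-}T$ with the induced symmetric monoidal structure, so that $X\mapsto X^\alpha$ is exact and symmetric monoidal. A (commutative) $\mathfrak o$-algebra $A$ of $T$ thus gives a commutative monoid $A^\alpha$ in $\alpha\text{-}T$. An $A^\alpha$-module is a module over this monoid in $\alpha\text{-}T$; these form an abelian category, with a tensor product $\otimes_{A^\alpha}$ and groups $\mathrm{Ext}^n_{A^\alpha}$. Let $A\to A_0$ be a surjection of commutative $\mathfrak o$-algebras of $T$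 whose kernel $I$ has square zero. Then $I^\alpha$ is an $A_0^\alpha$-module. Let $M_0$, $J$ be $A_0^\alpha$-modules. For an extension of $A^\alpha$-modules $\widetilde M=(0\to J\to M\to M_0\to 0)$, let $$u^\alpha(\widetilde M):\ I^\alpha\otimes_{A_0^\alpha}M_0\longrightarrow J$$ be the unique $A_0^\alpha$-linear map such that the composite $I^\alpha\otimes M\to I^\alpha\otimes_{A_0^\alpha}M_0\xrightarrow{u^\alpha(\widetilde M)}J\to M$ is the multiplication map $I^\alpha\otimes M\to A^\alpha\otimes M\to M$. **Theorem.** There are homomorphisms, for all $A_0^\alpha$-modules $M_0$, $J$, $$\partial^\alpha:\ \mathrm{Hom}_{A_0^\alpha}(I^\alpha\otimes_{A_0^\alpha}M_0,J)\longrightarrow \mathrm{Ext}^2_{A_0^\alpha}(M_0,J),$$ which are the connecting maps associated with $0\to \mathrm{Ext}^1_{A_0^\alpha}(M_0,-)\to \mathrm{Ext}^1_{A^\alpha}(M_0,-)\xrightarrow{u^\alpha}\mathrm{Hom}_{A_0^\alpha}(I^\alpha\otimes_{A_0^\alpha}M_0,-)$ in the following sense: if $0\to J\xrightarrow{f} Q\xrightarrow{g}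 R\to 0$ is an exact sequence of $A_0^\alpha$-modules, $u_0: I^\alpha\otimes_{A_0^\alpha}M_0\to J$ is a linear map, $\widetilde M$ is an extension of $A^\alpha$-modules of $M_0$ by $Q$ with $u^\alpha(\widetilde M)=f\circ u_0$, and $e\in\mathrm{Ext}^1_{A_0^\alpha}(M_0,R)$ has as restriction of scalars to $A^\alpha$ the image under $g$ of the class of $\widetilde M$, then $\partial^\alpha(u_0)$ is the Yoneda product of $e$ with the class of $0\to J\to Q\to R\to 0$ in $\mathrm{Ext}^1_{A_0^\alpha}(R,J)$. For all $A_0^\alpha$-modules $M_0$, $J$ and every $A_0^\alpha$-linear map $u_0:I^\alpha\otimes_{A_0^\alpha}M_0\to J$: (i) the obstruction $\partial^\alpha(u_0)\in\mathrm{Ext}^2_{A_0^\alpha}(M_0,J)$ vanishes if and only if there exists an extension $\widetilde M$ of $A^\alpha$-modules of $M_0$ by $J$ such that $u^\alpha(\widetilde M)=u_0$; (ii) if $\partial^\alpha(u_0)=0$, the set of isomorphism classes of such extensions $\widetilde M$ is a (non-empty) torsor under $\mathrm{Ext}^1_{A_0^\alpha}(M_0,J)$, where $e\in \mathrm{Ext}^1_{A_0^\alpha}(M_0,J)$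 acts by adding (Baer sum) in $\mathrm{Ext}^1_{A^\alpha}(M_0,J)$ the class obtained from $e$ by restriction of scalars along $A^\alpha\to A_0^\alpha$. -/

import Mathlib

open CategoryTheory Limits MonoidalCategory
open scoped MonoidalLeftAction

namespace AlmostDeformation

section ModAbelian

variable {D : Type*} [Category D] [MonoidalCategory D]

/-- The action map `A ⊗ M ⟶ M` of an `A`-module `M`. -/
abbrev act {A : D} [MonObj A] (M : CategoryTheory.Mod D A) : A ⊗ M.X ⟶ M.X :=
  ModObj.smul (M := A) (X := M.X)

/-- An `A`-module from an action map. -/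
abbrev mkMod {A : D} [MonObj A] (X : D) (a : A ⊗ X ⟶ X)
    (h₁ : MonObj.one ▷ X ≫ a = (λ_ X).hom)
    (h₂ : MonObj.mul ▷ X ≫ a = (α_ A A X).hom ≫ A ◁ a ≫ a) : CategoryTheory.Mod D A :=
  letI : ModObj A X := ⟨a, h₁, h₂⟩
  ⟨X⟩

/-- An `A`-linear morphism from a morphism that commutes with the action maps. -/
abbrev mkHom {A : D} [MonObj A] {M N : CategoryTheory.Mod D A} (f : M.X ⟶ N.X)
    (h : act M ≫ f = A ◁ f ≫ act N) : M ⟶ N :=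
  Mod.Hom.mk' f h

section
variable {A : D} [MonObj A]

lemma one_act (M : CategoryTheory.Mod D A) : MonObj.one ▷ M.X ≫ act M = (λ_ M.X).hom :=
  ModObj.one_smul_self A M.X

lemma mul_act (M : CategoryTheory.Mod D A) :
    MonObj.mul ▷ M.X ≫ act M = (α_ A A M.X).hom ≫ A ◁ act M ≫ act M :=
  ModObj.mul_smul_self A M.X

lemma act_hom {M N : CategoryTheory.Mod D A} (f : M ⟶ N) :
    act M ≫ f.hom = A ◁ f.hom ≫ act N :=
  IsModHom.smul_hom

end

instance modPreadditive [Preadditive D] [MonoidalPreadditive D] (A : D) [MonObj A] :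
    Preadditive (CategoryTheory.Mod D A) where
  homGroup M N :=
    letI : Zero (M ⟶ N) := ⟨Mod.Hom.mk' 0⟩
    letI : Add (M ⟶ N) := ⟨fun f g => Mod.Hom.mk' (f.hom + g.hom)⟩
    letI : Neg (M ⟶ N) := ⟨fun f => Mod.Hom.mk' (-f.hom) (by
      have := (tensorLeft A).map_neg (f := f.hom)
      simp at this; simp [this])⟩
    letI : Sub (M ⟶ N) := ⟨fun f g => Mod.Hom.mk' (f.hom - g.hom) (by
      have := (tensorLeft A).map_sub (f := f.hom) (g := g.hom)
      simp at this; simp [this])⟩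
    letI : SMul ℕ (M ⟶ N) := ⟨fun n f => Mod.Hom.mk' (n • f.hom) (by
      have := (tensorLeft A).map_nsmul (f := f.hom) (n := n)
      simp at this; simp [this])⟩
    letI : SMul ℤ (M ⟶ N) := ⟨fun n f => Mod.Hom.mk' (n • f.hom) (by
      have := (tensorLeft A).map_zsmul (f := f.hom) (r := n)
      simp at this; simp [this])⟩
    Function.Injective.addCommGroup (fun f : M ⟶ N => f.hom) (fun _ _ h => Mod.hom_ext _ _ h)
      rfl (fun _ _ => rfl) (fun _ => rfl) (fun _ _ => rfl) (fun _ _ => rfl) (fun _ _ => rfl)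
  add_comp _ _ _ f g h := Mod.hom_ext _ _ (Preadditive.add_comp _ _ _ f.hom g.hom h.hom)
  comp_add _ _ _ f g h := Mod.hom_ext _ _ (Preadditive.comp_add _ _ _ f.hom g.hom h.hom)

instance modForget_additive [Preadditive D] [MonoidalPreadditive D] (A : D) [MonObj A] :
    (Mod.forget (D := D) A).Additive where
  map_add := rfl

instance modForget_faithful (A : D) [MonObj A] : (Mod.forget (D := D) A).Faithful where
  map_injective h := Mod.hom_ext _ _ h

instance modForget_reflects (A : D) [MonObj A] :
    (Mod.forget (D := D) A).ReflectsIsomorphisms where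
  reflects {M N} f hf := by
    have : IsIso f.hom := hf
    refine ⟨Mod.Hom.mk' (inv f.hom) ?_, ?_, ?_⟩
    · have h := act_hom f
      rw [IsIso.comp_inv_eq, Category.assoc, h]
      simp
    · ext; simp
    · ext; simp

/-- The monad `A ⊗ -`, whose algebras are the `A`-modules. -/
@[reducible]
def modMonad (A : D) [MonObj A] : Monad D where
  toFunctor := tensorLeft A
  η := { app X := (λ_ X).inv ≫ MonObj.one ▷ X
         naturality X Y f := by simp [← whisker_exchange] }
  μ := { app X := (α_ A A X).inv ≫ MonObj.mul ▷ X
         naturality X Y f := by simp [← whisker_exchange] }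
  assoc X := by
    dsimp
    rw [← cancel_epi (A ◁ (α_ A A X).hom), ← cancel_epi (α_ A (A ⊗ A) X).hom]
    simp only [Category.assoc, MonoidalCategory.whiskerLeft_comp,
      whiskerLeft_hom_inv_assoc]
    rw [associator_inv_naturality_middle_assoc, associator_inv_naturality_left_assoc,
      Iso.hom_inv_id_assoc, ← comp_whiskerRight, ← comp_whiskerRight, MonObj.mul_assoc_flip]
    simp
  left_unit X := by
    dsimp
    rw [Category.assoc, associator_inv_naturality_left_assoc, ← comp_whiskerRight,
      MonObj.one_mul]
    simp
  right_unit X := by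
    dsimp
    rw [MonoidalCategory.whiskerLeft_comp, Category.assoc, associator_inv_naturality_middle_assoc,
      ← comp_whiskerRight, MonObj.mul_one]
    simp

/-- Modules over a monoid object are algebras over the associated monad. -/
def modToAlgebra (A : D) [MonObj A] : CategoryTheory.Mod D A ⥤ (modMonad A).Algebra where
  obj M :=
    { A := M.X
      a := act M
      unit := by simp
      assoc := by simp }
  map f := { f := f.hom, h := (act_hom f).symm }

instance modToAlgebra_isEquivalence (A : D) [MonObj A] : (modToAlgebra A).IsEquivalence where
  faithful := ⟨fun h => Mod.hom_ext _ _ (congrArg Monad.Algebra.Hom.f h)⟩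
  full := ⟨fun g => ⟨mkHom g.f g.h.symm, rfl⟩⟩
  essSurj := ⟨fun M => ⟨mkMod M.A M.a
    (by have h := M.unit; simpa [Iso.inv_comp_eq] using h)
    (by have h := M.assoc; simpa [Iso.inv_comp_eq] using h),
    ⟨Monad.Algebra.isoMk (Iso.refl _) (by simp [modToAlgebra]; rfl)⟩⟩⟩

section abelian

variable [Abelian D] [MonoidalPreadditive D] [∀ X : D, PreservesFiniteColimits (tensorLeft X)]
  (A : D) [MonObj A]

instance : PreservesFiniteColimits (modMonad A).toFunctor :=
  inferInstanceAs (PreservesFiniteColimits (tensorLeft A))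

lemma algebra_hasFiniteLimits : HasFiniteLimits (modMonad A).Algebra where
  out _ _ _ := hasLimitsOfShape_of_hasLimitsOfShape_createsLimitsOfShape (modMonad A).forget

lemma algebra_hasFiniteColimits : HasFiniteColimits (modMonad A).Algebra where
  out _ _ _ := hasColimitsOfShape_of_hasColimitsOfShape_createsColimitsOfShape (modMonad A).forget

instance mod_hasFiniteLimits : HasFiniteLimits (CategoryTheory.Mod D A) where
  out _ _ _ :=
    have := algebra_hasFiniteLimits (D := D) A
    Adjunction.hasLimitsOfShape_of_equivalence (modToAlgebra A)

instance mod_hasFiniteColimits : HasFiniteColimits (CategoryTheory.Mod D A) where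
  out _ _ _ :=
    have := algebra_hasFiniteColimits A
    Adjunction.hasColimitsOfShape_of_equivalence (modToAlgebra A)

instance modForget_preservesFiniteLimits :
    PreservesFiniteLimits (Mod.forget (D := D) A) where
  preservesFiniteLimits J _ _ :=
    inferInstanceAs (PreservesLimitsOfShape J (modToAlgebra A ⋙ (modMonad A).forget))

instance modForget_preservesFiniteColimits :
    PreservesFiniteColimits (Mod.forget (D := D) A) where
  preservesFiniteColimits J _ _ :=
    inferInstanceAs (PreservesColimitsOfShape J (modToAlgebra A ⋙ (modMonad A).forget))

/-- Modules over a monoid object in an abelian monoidal category with right exact tensor product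
form an abelian category. -/
noncomputable instance modAbelian : Abelian (CategoryTheory.Mod D A) :=
  have (X Y : CategoryTheory.Mod D A) (f : X ⟶ Y) : IsIso (Abelian.coimageImageComparison f) := by
    have : IsIso ((Mod.forget A).map (Abelian.coimageImageComparison f)) :=
      IsIso.of_isIso_fac_right (Abelian.PreservesCoimage.hom_coimageImageComparison
        (Mod.forget A) f).symm
    exact isIso_of_reflects_iso _ (Mod.forget A)
  Abelian.ofCoimageImageComparisonIsIso

end abelian

section comap

variable [Abelian D] [MonoidalPreadditive D] [∀ X : D, PreservesFiniteColimits (tensorLeft X)]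
  {A B : D} [MonObj A] [MonObj B] (f : A ⟶ B) [IsMonHom f]

instance comap_additive : (Mod.comap (D := D) f).Additive where
  map_add := rfl

instance comap_preservesFiniteLimits : PreservesFiniteLimits (Mod.comap (D := D) f) where
  preservesFiniteLimits J _ _ :=
    have : PreservesLimitsOfShape J (Mod.comap (D := D) f ⋙ Mod.forget A) :=
      inferInstanceAs (PreservesLimitsOfShape J (Mod.forget B))
    preservesLimitsOfShape_of_reflects_of_preserves _ (Mod.forget A)

instance comap_preservesFiniteColimits : PreservesFiniteColimits (Mod.comap (D := D) f) where
  preservesFiniteColimits J _ _ :=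
    have : PreservesColimitsOfShape J (Mod.comap (D := D) f ⋙ Mod.forget A) :=
      inferInstanceAs (PreservesColimitsOfShape J (Mod.forget B))
    preservesColimitsOfShape_of_reflects_of_preserves _ (Mod.forget A)

end comap

end ModAbelian
end AlmostDeformation

namespace AlmostDeformation

section Tensor

variable {D : Type*} [Category D] [MonoidalCategory D] [SymmetricCategory D] [Abelian D]
  [MonoidalPreadditive D] [∀ X : D, PreservesFiniteColimits (tensorLeft X)]

instance whiskerLeft_epi (X : D) {Y Z : D} (g : Y ⟶ Z) [Epi g] : Epi (X ◁ g) :=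
  inferInstanceAs (Epi ((tensorLeft X).map g))

instance whiskerRight_epi (X : D) {Y Z : D} (g : Y ⟶ Z) [Epi g] : Epi (g ▷ X) := by
  have h : g ▷ X = (β_ Y X).hom ≫ X ◁ g ≫ (β_ Z X).inv := by simp
  rw [h]
  infer_instance

lemma exists_whiskerLeft_desc (X : D) {S : ShortComplex D} (hS : S.ShortExact) {Z : D}
    (k : X ⊗ S.X₂ ⟶ Z) (hk : X ◁ S.f ≫ k = 0) : ∃ l : X ⊗ S.X₃ ⟶ Z, X ◁ S.g ≫ l = k := by
  have := hS.epi_g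
  have h : (S.map (tensorLeft X)).Exact :=
    hS.exact.map_of_epi_of_preservesCokernel _ hS.epi_g inferInstance
  have : Epi (S.map (tensorLeft X)).g := inferInstanceAs (Epi (X ◁ S.g))
  exact ⟨h.desc k hk, h.g_desc k hk⟩

lemma exists_whiskerRight_desc (X : D) {S : ShortComplex D} (hS : S.ShortExact) {Z : D}
    (k : S.X₂ ⊗ X ⟶ Z) (hk : S.f ▷ X ≫ k = 0) : ∃ l : S.X₃ ⊗ X ⟶ Z, S.g ▷ X ≫ l = k := by
  obtain ⟨l, hl⟩ := exists_whiskerLeft_desc X hS ((β_ X S.X₂).hom ≫ k) (by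
    rw [BraidedCategory.braiding_naturality_right_assoc, hk, comp_zero])
  refine ⟨(β_ S.X₃ X).hom ≫ l, ?_⟩
  rw [BraidedCategory.braiding_naturality_left_assoc, hl]
  simp

variable {A : D} [MonObj A]

/-- The `A`-module `M ⊗ X`, where `A` acts on `M`. -/
abbrev modTensorObj (M : CategoryTheory.Mod D A) (X : D) : CategoryTheory.Mod D A :=
  mkMod (M.X ⊗ X) ((α_ A M.X X).inv ≫ act M ▷ X)
    (by
      rw [associator_inv_naturality_left_assoc, ← comp_whiskerRight, one_act]
      simp)
    (by
      rw [associator_inv_naturality_left_assoc, ← comp_whiskerRight, mul_act]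
      simp)

/-- The right action `M ⊗ A ⟶ M` of `A` on a module `M` over the commutative monoid `A`. -/
abbrev actRight (M : CategoryTheory.Mod D A) : M.X ⊗ A ⟶ M.X := (β_ M.X A).hom ≫ act M

/-- `M ⊗ (A ⊗ N) ⟶ M ⊗ N`, given by the action of `A` on `N`. -/
def tensorActSnd (M N : CategoryTheory.Mod D A) :
    modTensorObj M (A ⊗ N.X) ⟶ modTensorObj M N.X :=
  mkHom (M.X ◁ act N) (by
    change ((α_ A M.X (A ⊗ N.X)).inv ≫ act M ▷ (A ⊗ N.X)) ≫ M.X ◁ act N =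
      A ◁ (M.X ◁ act N) ≫ (α_ A M.X N.X).inv ≫ act M ▷ N.X
    rw [associator_inv_naturality_right_assoc, Category.assoc, ← whisker_exchange])

lemma act_actRight [IsCommMonObj A] (M : CategoryTheory.Mod D A) :
    act M ▷ A ≫ actRight M = (α_ A M.X A).hom ≫ A ◁ actRight M ≫ act M := by
  have h : A ◁ act M ≫ act M = (α_ A A M.X).inv ≫ MonObj.mul ▷ M.X ≫ act M := by
    rw [mul_act, Iso.inv_hom_id_assoc]
  rw [BraidedCategory.braiding_naturality_left_assoc, MonoidalCategory.whiskerLeft_comp,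
    Category.assoc, h, BraidedCategory.braiding_tensor_left_hom]
  simp only [Category.assoc, Iso.hom_inv_id_assoc]
  rw [← comp_whiskerRight_assoc, IsCommMonObj.mul_comm]

/-- `M ⊗ (A ⊗ N) ⟶ M ⊗ N`, given by the action of `A` on `M`. -/
def tensorActFst [IsCommMonObj A] (M N : CategoryTheory.Mod D A) :
    modTensorObj M (A ⊗ N.X) ⟶ modTensorObj M N.X :=
  mkHom ((α_ M.X A N.X).inv ≫ actRight M ▷ N.X) (by
    change ((α_ A M.X (A ⊗ N.X)).inv ≫ act M ▷ (A ⊗ N.X)) ≫ (α_ M.X A N.X).inv ≫ actRight M ▷ N.X =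
      A ◁ ((α_ M.X A N.X).inv ≫ actRight M ▷ N.X) ≫ (α_ A M.X N.X).inv ≫ act M ▷ N.X
    rw [Category.assoc, associator_inv_naturality_left_assoc, ← comp_whiskerRight, act_actRight]
    simp)

/-- The tensor product `M ⊗_A N` of modules over a commutative monoid `A`: the coequalizer of the
two maps `M ⊗ A ⊗ N ⇉ M ⊗ N`. -/
noncomputable abbrev modTensor [IsCommMonObj A] (M N : CategoryTheory.Mod D A) :
    CategoryTheory.Mod D A :=
  coequalizer (tensorActFst M N) (tensorActSnd M N)

/-- The canonical morphism `M ⊗ N ⟶ M ⊗_A N`. -/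
noncomputable abbrev modTensorπ [IsCommMonObj A] (M N : CategoryTheory.Mod D A) :
    M.X ⊗ N.X ⟶ (modTensor M N).X :=
  (coequalizer.π (tensorActFst M N) (tensorActSnd M N)).hom

end Tensor

section SquareZero

variable (D : Type*) [Category D] [MonoidalCategory D] [SymmetricCategory D] [Abelian D]

/-- An epimorphism `p : A ⟶ A₀` of commutative monoids whose kernel `ι : I ⟶ A` is an ideal of
square zero. -/
structure SquareZeroExtension where
  /-- the commutative monoid `A` -/
  A : D
  /-- the commutative monoid `A₀` -/
  A₀ : D
  /-- the kernel -/
  I : D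
  [monA : MonObj A]
  [commA : IsCommMonObj A]
  [monA₀ : MonObj A₀]
  [commA₀ : IsCommMonObj A₀]
  /-- the inclusion of the kernel -/
  ι : I ⟶ A
  /-- the epimorphism -/
  p : A ⟶ A₀
  [monHom : IsMonHom p]
  zero : ι ≫ p = 0
  shortExact : (ShortComplex.mk ι p zero).ShortExact
  mul_eq_zero : (ι ⊗ₘ ι) ≫ MonObj.mul = 0

end SquareZero

namespace SquareZeroExtension

attribute [instance] monA commA monA₀ commA₀ monHom

variable {D : Type*} [Category D] [MonoidalCategory D] [SymmetricCategory D] [Abelian D]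

section
variable (S : SquareZeroExtension D)

instance : Mono S.ι := S.shortExact.mono_f
instance : Epi S.p := S.shortExact.epi_g

variable [MonoidalPreadditive D] [∀ X : D, PreservesFiniteColimits (tensorLeft X)]

lemma exists_idealAct : ∃ a : S.A₀ ⊗ S.I ⟶ S.I, S.p ▷ S.I ≫ a ≫ S.ι = S.A ◁ S.ι ≫ MonObj.mul := by
  have h0 : (S.A ◁ S.ι ≫ MonObj.mul) ≫ S.p = 0 := by
    rw [Category.assoc, IsMonHom.mul_hom, tensorHom_def', Category.assoc,
      ← MonoidalCategory.whiskerLeft_comp_assoc, S.zero]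
    simp
  have h1 : S.shortExact.exact.lift (S.A ◁ S.ι ≫ MonObj.mul) h0 ≫ S.ι = _ :=
    letI := S.shortExact.mono_f
    S.shortExact.exact.lift_f _ h0
  obtain ⟨a, ha⟩ := exists_whiskerRight_desc S.I S.shortExact _
    (show S.ι ▷ S.I ≫ S.shortExact.exact.lift _ h0 = 0 by
      rw [← cancel_mono S.ι, Category.assoc, h1, zero_comp, ← S.mul_eq_zero, MonoidalCategory.tensorHom_def,
        Category.assoc])
  refine ⟨a, ?_⟩
  change S.p ▷ S.I ≫ a = _ at ha
  rw [reassoc_of% ha, h1]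

/-- The action of `A₀` on the square zero ideal `I`, induced by the multiplication of `A`. -/
noncomputable def idealAct : S.A₀ ⊗ S.I ⟶ S.I := S.exists_idealAct.choose

lemma idealAct_spec : S.p ▷ S.I ≫ S.idealAct ≫ S.ι = S.A ◁ S.ι ≫ MonObj.mul :=
  S.exists_idealAct.choose_spec

/-- The square zero ideal `I`, as an `A₀`-module. -/
noncomputable abbrev ideal : CategoryTheory.Mod D S.A₀ :=
  mkMod S.I S.idealAct
    (by
      rw [← cancel_mono S.ι, ← IsMonHom.one_hom S.p, comp_whiskerRight, Category.assoc,
        Category.assoc, idealAct_spec, ← whisker_exchange_assoc, MonObj.one_mul,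
        leftUnitor_naturality])
    (by
      have : Epi (S.p ⊗ₘ S.p) := by
        rw [MonoidalCategory.tensorHom_def]
        infer_instance
      rw [← cancel_mono S.ι, ← cancel_epi ((S.p ⊗ₘ S.p) ▷ S.I)]
      simp only [Category.assoc]
      rw [← comp_whiskerRight_assoc, ← IsMonHom.mul_hom, comp_whiskerRight_assoc, idealAct_spec,
        MonoidalCategory.tensorHom_def, comp_whiskerRight_assoc, associator_naturality_middle_assoc,
        associator_naturality_left_assoc, ← whisker_exchange_assoc S.p,
        ← whisker_exchange_assoc S.p, idealAct_spec, ← MonoidalCategory.whiskerLeft_comp_assoc,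
        ← MonoidalCategory.whiskerLeft_comp_assoc, Category.assoc, idealAct_spec,
        ← whisker_exchange_assoc, MonoidalCategory.whiskerLeft_comp_assoc,
        MonObj.mul_assoc_flip]
      simp)

/-- Restriction of scalars along `A ⟶ A₀`. -/
abbrev res : CategoryTheory.Mod D S.A₀ ⥤ CategoryTheory.Mod D S.A := Mod.comap S.p

end

end SquareZeroExtension
end AlmostDeformation

namespace AlmostDeformation

open CategoryTheory.Abelian

namespace SquareZeroExtension

universe v w

variable {D : Type w} [Category.{v} D] [MonoidalCategory D] [SymmetricCategory D] [Abelian D]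
  [MonoidalPreadditive D] [∀ X : D, PreservesFiniteColimits (tensorLeft X)]
  (S : SquareZeroExtension D)

/-- An extension `0 ⟶ J ⟶ M ⟶ M₀ ⟶ 0` of `A`-modules of an `A₀`-module `M₀` by an
`A₀`-module `J`. -/
structure ModExtension (M₀ J : CategoryTheory.Mod D S.A₀) where
  /-- the middle term -/
  M : CategoryTheory.Mod D S.A
  /-- the inclusion -/
  f : S.res.obj J ⟶ M
  /-- the projection -/
  g : M ⟶ S.res.obj M₀
  zero : f ≫ g = 0
  shortExact : (ShortComplex.mk f g zero).ShortExact

namespace ModExtension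

variable {S} {M₀ J : CategoryTheory.Mod D S.A₀} (E : S.ModExtension M₀ J)

/-- The morphism of `D` underlying `J ⟶ M`. -/
def i : J.X ⟶ E.M.X := E.f.hom

/-- The morphism of `D` underlying `M ⟶ M₀`. -/
def q : E.M.X ⟶ M₀.X := E.g.hom

lemma shortExact_hom :
    (ShortComplex.mk E.i E.q (congrArg Mod.Hom.hom E.zero)).ShortExact :=
  E.shortExact.map_of_exact (Mod.forget S.A)

instance : Mono E.i := E.shortExact_hom.mono_f
instance : Epi E.q := E.shortExact_hom.epi_g

lemma act_i : S.p ▷ J.X ≫ act J ≫ E.i = S.A ◁ E.i ≫ act E.M := by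
  have h : (S.p ▷ J.X ≫ act J) ≫ E.i = S.A ◁ E.i ≫ act E.M := act_hom E.f
  rw [← h, Category.assoc]

lemma act_q : act E.M ≫ E.q = S.A ◁ E.q ≫ S.p ▷ M₀.X ≫ act M₀ := act_hom E.g

/-- There is a unique `b : I ⊗ M₀ ⟶ J` such that the two maps `I ⊗ M ⟶ I ⊗ M₀ ⟶ J ⟶ M` and
`I ⊗ M ⟶ A ⊗ M ⟶ M` coincide. -/
lemma exists_pairing : ∃ b : S.I ⊗ M₀.X ⟶ J.X,
    S.I ◁ E.q ≫ b ≫ E.i = S.ι ▷ E.M.X ≫ act E.M := by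
  have h0 : (S.ι ▷ E.M.X ≫ act E.M) ≫ E.q = 0 := by
    rw [Category.assoc, act_q, ← whisker_exchange_assoc, ← comp_whiskerRight_assoc, S.zero]
    simp
  have h1 : E.shortExact_hom.exact.lift _ h0 ≫ E.i = _ :=
    E.shortExact_hom.exact.lift_f _ h0
  obtain ⟨b, hb⟩ := exists_whiskerLeft_desc S.I E.shortExact_hom _
    (show S.I ◁ E.i ≫ E.shortExact_hom.exact.lift _ h0 = 0 by
      rw [← cancel_mono E.i, Category.assoc, h1, zero_comp, whisker_exchange_assoc,
        ← act_i, ← comp_whiskerRight_assoc, S.zero]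
      simp)
  refine ⟨b, ?_⟩
  change S.I ◁ E.q ≫ b = _ at hb
  rw [reassoc_of% hb, h1]

/-- The map `I ⊗ M₀ ⟶ J` induced by the multiplication `I ⊗ M ⟶ M`. -/
noncomputable def pairing : S.I ⊗ M₀.X ⟶ J.X := E.exists_pairing.choose

lemma pairing_spec : S.I ◁ E.q ≫ E.pairing ≫ E.i = S.ι ▷ E.M.X ≫ act E.M :=
  E.exists_pairing.choose_spec

/-- `E.pairing`, as an `A₀`-linear map. -/
noncomputable def linearPairing : modTensorObj S.ideal M₀.X ⟶ J :=
  mkHom E.pairing (by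
    change ((α_ S.A₀ S.I M₀.X).inv ≫ S.idealAct ▷ M₀.X) ≫ E.pairing = S.A₀ ◁ E.pairing ≫ act J
    rw [← cancel_mono E.i, ← cancel_epi (S.A₀ ◁ (S.I ◁ E.q)),
      ← cancel_epi (S.p ▷ (S.I ⊗ E.M.X))]
    have h1 : S.p ▷ (S.I ⊗ E.M.X) ≫ S.A₀ ◁ S.I ◁ E.q ≫
        ((α_ S.A₀ S.I M₀.X).inv ≫ S.idealAct ▷ M₀.X) ≫ E.pairing ≫ E.i =
        S.A ◁ (S.ι ▷ E.M.X ≫ act E.M) ≫ act E.M := by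
      rw [Category.assoc, associator_inv_naturality_right_assoc, whisker_exchange_assoc,
        pairing_spec, associator_inv_naturality_left_assoc, ← comp_whiskerRight_assoc,
        ← comp_whiskerRight_assoc, Category.assoc, idealAct_spec, comp_whiskerRight_assoc,
        mul_act]
      simp
    have h2 : S.p ▷ (S.I ⊗ E.M.X) ≫ S.A₀ ◁ S.I ◁ E.q ≫
        S.A₀ ◁ E.pairing ≫ act J ≫ E.i =
        S.A ◁ (S.ι ▷ E.M.X ≫ act E.M) ≫ act E.M := by
      rw [← whisker_exchange_assoc, ← whisker_exchange_assoc, act_i,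
        ← MonoidalCategory.whiskerLeft_comp_assoc, ← MonoidalCategory.whiskerLeft_comp_assoc,
        Category.assoc, pairing_spec]
    simp only [Category.assoc] at h1 h2 ⊢
    rw [h1, h2])

/-- The `A₀`-linear map `u(E) : I ⊗_{A₀} M₀ ⟶ J` attached to an extension `E` of `A`-modules of
`M₀` by `J`: the composite `I ⊗ M ⟶ I ⊗_{A₀} M₀ ⟶ J ⟶ M` is the multiplication `I ⊗ M ⟶ M`. -/
noncomputable def u : modTensor S.ideal M₀ ⟶ J :=
  coequalizer.desc E.linearPairing (by
    apply Mod.hom_ext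
    change ((α_ S.I S.A₀ M₀.X).inv ≫ ((β_ S.I S.A₀).hom ≫ S.idealAct) ▷ M₀.X) ≫ E.pairing =
      S.I ◁ act M₀ ≫ E.pairing
    rw [← cancel_mono E.i, ← cancel_epi (S.I ◁ (S.A₀ ◁ E.q)),
      ← cancel_epi (S.I ◁ (S.p ▷ E.M.X))]
    have h1 : S.I ◁ act E.M ≫ S.ι ▷ E.M.X ≫ act E.M =
        (α_ S.I S.A E.M.X).inv ≫ (S.ι ▷ S.A ≫ MonObj.mul) ▷ E.M.X ≫ act E.M := by
      rw [whisker_exchange_assoc, comp_whiskerRight_assoc, mul_act]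
      simp
    have h2 : S.I ◁ S.p ≫ (β_ S.I S.A₀).hom ≫ S.idealAct ≫ S.ι = S.ι ▷ S.A ≫ MonObj.mul := by
      rw [BraidedCategory.braiding_naturality_right_assoc, idealAct_spec,
        ← BraidedCategory.braiding_naturality_left_assoc, IsCommMonObj.mul_comm]
    have h3 : S.p ▷ E.M.X ≫ S.A₀ ◁ E.q ≫ act M₀ = act E.M ≫ E.q := by
      rw [act_q, whisker_exchange_assoc]
    simp only [Category.assoc]
    rw [associator_inv_naturality_right_assoc, whisker_exchange_assoc, pairing_spec,
      associator_inv_naturality_middle_assoc, ← comp_whiskerRight_assoc,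
      ← comp_whiskerRight_assoc, Category.assoc, Category.assoc, h2,
      ← MonoidalCategory.whiskerLeft_comp_assoc, ← MonoidalCategory.whiskerLeft_comp_assoc,
      Category.assoc, h3, MonoidalCategory.whiskerLeft_comp_assoc, pairing_spec, h1])

lemma u_spec : S.I ◁ E.q ≫ modTensorπ S.ideal M₀ ≫ E.u.hom ≫ E.i =
    S.ι ▷ E.M.X ≫ act E.M := by
  have h : modTensorπ S.ideal M₀ ≫ E.u.hom = E.pairing :=
    congrArg Mod.Hom.hom (coequalizer.π_desc (f := tensorActFst S.ideal M₀)
      (g := tensorActSnd S.ideal M₀) E.linearPairing _)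
  rw [reassoc_of% h, pairing_spec]

/-- Two extensions are isomorphic if there is an isomorphism between their middle terms that
induces the identity on `J` and on `M₀`. -/
def isoSetoid (u₀ : modTensor S.ideal M₀ ⟶ J) : Setoid {E : S.ModExtension M₀ J // E.u = u₀} where
  r E E' := ∃ e : E.1.M ≅ E'.1.M, E.1.f ≫ e.hom = E'.1.f ∧ e.hom ≫ E'.1.g = E.1.g
  iseqv :=
    { refl := fun _ => ⟨Iso.refl _, by simp, by simp⟩
      symm := fun ⟨e, h₁, h₂⟩ => ⟨e.symm, by simp [← h₁], by simp [← h₂]⟩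
      trans := fun ⟨e, h₁, h₂⟩ ⟨e', h₁', h₂'⟩ =>
        ⟨e ≪≫ e', by simp [reassoc_of% h₁, h₁'], by simp [h₂, h₂']⟩ }

end ModExtension

/-- The set of isomorphism classes of extensions `E` of `A`-modules of `M₀` by `J`
such that `u(E) = u₀`. -/
def ExtensionClasses {M₀ J : CategoryTheory.Mod D S.A₀} (u₀ : modTensor S.ideal M₀ ⟶ J) : Type _ :=
  Quotient (ModExtension.isoSetoid u₀)

section Ext

instance mod_hasExt (A : D) [MonObj A] : HasExt.{max w v} (CategoryTheory.Mod D A) :=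
  HasExt.standard _

/-- The class in `Ext¹_A(M₀, J)` of an extension of `A`-modules. -/
noncomputable def ModExtension.extClass {S : SquareZeroExtension D}
    {M₀ J : CategoryTheory.Mod D S.A₀} (E : S.ModExtension M₀ J) :
    Ext.{max w v} (S.res.obj M₀) (S.res.obj J) 1 :=
  E.shortExact.extClass

end Ext

end SquareZeroExtension

end AlmostDeformation

namespace AlmostDeformation

open CategoryTheory.Abelian

namespace SquareZeroExtension

universe v w

section map

variable {D D' : Type*} [Category D] [MonoidalCategory D] [SymmetricCategory D] [Abelian D]
  [Category D'] [MonoidalCategory D'] [SymmetricCategory D'] [Abelian D']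

open scoped Obj in
/-- The image of a square zero extension under an exact symmetric monoidal functor. -/
def map (S : SquareZeroExtension D) (F : D ⥤ D') [F.Braided] [F.Additive]
    [PreservesFiniteLimits F] [PreservesFiniteColimits F] : SquareZeroExtension D' where
  A := F.obj S.A
  A₀ := F.obj S.A₀
  I := F.obj S.I
  ι := F.map S.ι
  p := F.map S.p
  zero := by rw [← F.map_comp, S.zero, F.map_zero]
  shortExact := S.shortExact.map_of_exact F
  mul_eq_zero := by
    simp only [Functor.obj.μ_def]
    rw [Functor.LaxMonoidal.μ_natural_assoc, ← F.map_comp, S.mul_eq_zero, F.map_zero, comp_zero]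

end map

variable {D : Type w} [Category.{v} D] [MonoidalCategory D] [SymmetricCategory D] [Abelian D]
  [MonoidalPreadditive D] [∀ X : D, PreservesFiniteColimits (tensorLeft X)]
  (S : SquareZeroExtension D)

/-- The class in `Ext¹_A(M₀, J)` of an isomorphism class of extensions. -/
noncomputable def ExtensionClasses.extClass {S : SquareZeroExtension D}
    {M₀ J : CategoryTheory.Mod D S.A₀} {u₀ : modTensor S.ideal M₀ ⟶ J}
    (x : S.ExtensionClasses u₀) : Ext.{max w v} (S.res.obj M₀) (S.res.obj J) 1 :=
  Quotient.lift (fun E => E.1.extClass) (by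
    rintro ⟨E, _⟩ ⟨E', _⟩ ⟨e, h₁, h₂⟩
    let φ : ShortComplex.mk E.f E.g E.zero ⟶ ShortComplex.mk E'.f E'.g E'.zero :=
      { τ₁ := 𝟙 _, τ₂ := e.hom, τ₃ := 𝟙 _
        comm₁₂ := by simpa using h₁.symm
        comm₂₃ := by simpa using h₂ }
    have h := ShortComplex.ShortExact.extClass_naturality E.shortExact E'.shortExact φ
    change E.shortExact.extClass = E'.shortExact.extClass
    simpa [φ] using h) x

/-- Restriction of scalars `Extⁿ_{A₀}(M₀, J) ⟶ Extⁿ_A(M₀, J)`. -/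
noncomputable def resExt (M₀ J : CategoryTheory.Mod D S.A₀) (n : ℕ) :
    Ext.{max w v} M₀ J n →+ Ext.{max w v} (S.res.obj M₀) (S.res.obj J) n :=
  S.res.mapExtAddHom M₀ J n

/-- The maps `∂ : Hom_{A₀}(I ⊗_{A₀} M₀, J) ⟶ Ext²_{A₀}(M₀, J)` are the connecting homomorphisms
associated with `0 ⟶ Ext¹_{A₀}(M₀, -) ⟶ Ext¹_A(M₀, -) ⟶ Hom_{A₀}(I ⊗_{A₀} M₀, -)`: if
`0 ⟶ J ⟶ Q ⟶ R ⟶ 0` is an exact sequence of `A₀`-modules such that the image of `u₀` in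
`Hom_{A₀}(I ⊗_{A₀} M₀, Q)` is `u(E)` for some extension `E` of `A`-modules of `M₀` by `Q`, and if
the image of the class of `E` in `Ext¹_A(M₀, R)` comes from `e ∈ Ext¹_{A₀}(M₀, R)`, then `∂ u₀` is
the image of `e` under the connecting homomorphism `Ext¹_{A₀}(M₀, R) ⟶ Ext²_{A₀}(M₀, J)`. -/
def IsConnecting (d : ∀ M₀ J : CategoryTheory.Mod D S.A₀,
    (modTensor S.ideal M₀ ⟶ J) →+ Ext.{max w v} M₀ J 2) : Prop :=
  ∀ (M₀ : CategoryTheory.Mod D S.A₀) (T : ShortComplex (CategoryTheory.Mod D S.A₀))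
    (hT : T.ShortExact) (u₀ : modTensor S.ideal M₀ ⟶ T.X₁) (E : S.ModExtension M₀ T.X₂)
    (e : Ext.{max w v} M₀ T.X₃ 1),
    E.u = u₀ ≫ T.f →
    S.resExt M₀ T.X₃ 1 e = E.extClass.comp (Ext.mk₀ (S.res.map T.g)) (add_zero 1) →
    d M₀ T.X₁ u₀ = e.comp hT.extClass rfl

end SquareZeroExtension

end AlmostDeformation

namespace AlmostDeformation

open CategoryTheory.Abelian

/-- A right exact tensor product is additive in each variable. -/
lemma monoidalPreadditive_of_rightExact (D : Type*) [Category D] [Abelian D] [MonoidalCategory D]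
    [SymmetricCategory D] [∀ X : D, PreservesFiniteColimits (tensorLeft X)] :
    MonoidalPreadditive D := by
  have h (X : D) : (tensorLeft X).Additive := by
    have := preservesBinaryBiproducts_of_preservesBinaryCoproducts (tensorLeft X)
    exact Functor.additive_of_preservesBinaryBiproducts _
  have h₀ {X Y Z : D} (f : Y ⟶ Z) : f ▷ X = (β_ Y X).hom ≫ X ◁ f ≫ (β_ Z X).inv := by
    simp
  have hz {X Y Z : D} : X ◁ (0 : Y ⟶ Z) = 0 := (tensorLeft X).map_zero _ _
  have ha {X Y Z : D} (f g : Y ⟶ Z) : X ◁ (f + g) = X ◁ f + X ◁ g :=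
    (tensorLeft X).map_add
  exact
    { whiskerLeft_zero := hz
      zero_whiskerRight := by intros; rw [h₀, hz]; simp
      whiskerLeft_add := ha
      add_whiskerRight := by intros; rw [h₀, ha, h₀, h₀]; simp }

section Almost

universe u v w

variable (R : Type u) [CommRing R] (m : Ideal R)

/-- An object of an `R`-linear category is `α`-null if it is annihilated by every element of the
ideal `m`. -/
def alphaNull (D : Type w) [Category.{v} D] [Preadditive D] [Linear R D] : ObjectProperty D :=
  fun X => ∀ a ∈ m, a • 𝟙 X = 0

variable {R} (D : Type w) [Category.{v} D] [Abelian D] [Linear R D]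

lemma alphaNull_of_mul [hm : Fact (IsIdempotentElem m)] {X : D}
    (h : ∀ a ∈ m, ∀ b ∈ m, (a * b) • 𝟙 X = 0) : alphaNull R m D X := by
  intro r hr
  rw [← hm.out.eq] at hr
  induction hr using Submodule.mul_induction_on' with
  | mem_mul_mem a ha b hb => exact h a ha b hb
  | add x _ y _ hx hy => rw [add_smul, hx, hy, add_zero]

instance alphaNull_isSerreClass [Fact (IsIdempotentElem m)] : (alphaNull R m D).IsSerreClass where
  exists_zero := ⟨_, isZero_zero D, fun a _ => (isZero_zero D).eq_of_src _ _⟩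
  prop_of_mono {X Y} f _ hY a ha := by
    rw [← cancel_mono f, zero_comp, Linear.smul_comp, Category.id_comp, ← Category.comp_id f,
      ← Linear.comp_smul, hY a ha, comp_zero]
  prop_of_epi {X Y} f _ hX a ha := by
    rw [← cancel_epi f, comp_zero, Linear.comp_smul, Category.comp_id, ← Category.id_comp f,
      ← Linear.smul_comp, hX a ha, zero_comp]
  prop_X₂_of_shortExact {S} hS h₁ h₃ := alphaNull_of_mul m D (fun a ha b hb => by
    have := hS.mono_f
    have h : (b • 𝟙 S.X₂) ≫ S.g = 0 := by
      rw [Linear.smul_comp, Category.id_comp, ← Category.comp_id S.g, ← Linear.comp_smul,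
        h₃ b hb, comp_zero]
    have h' : a • hS.exact.lift _ h = 0 := by
      rw [← Category.comp_id (hS.exact.lift _ h), ← Linear.comp_smul, h₁ a ha, comp_zero]
    rw [mul_smul, ← hS.exact.lift_f _ h, ← Linear.smul_comp, h', zero_comp])

/-- The `α`-isomorphisms: morphisms whose kernel and cokernel are `α`-null. -/
abbrev alphaIso [Fact (IsIdempotentElem m)] : MorphismProperty D :=
  (alphaNull R m D).isoModSerre

variable {D}

lemma alphaIso_iff [Fact (IsIdempotentElem m)] {X Y : D} (f : X ⟶ Y) :
    alphaIso m D f ↔ ∀ a ∈ m, ∀ b ∈ m, ∃ g : Y ⟶ X, f ≫ g = (a * b) • 𝟙 X ∧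
      g ≫ f = (a * b) • 𝟙 Y := by
  constructor
  · rintro ⟨h₁, h₂⟩ a ha b hb
    have hk : kernel.ι (Abelian.factorThruImage f) ≫ (a • 𝟙 X) = 0 := by
      have : kernel.ι (Abelian.factorThruImage f) ≫ f = 0 := by
        conv_lhs => enter [2]; rw [← Abelian.image.fac f]
        rw [kernel.condition_assoc, zero_comp]
      rw [← kernel.lift_ι f _ this, Category.assoc, Linear.comp_smul, Category.comp_id,
        ← Category.id_comp (kernel.ι f), ← Linear.smul_comp, h₁ a ha, zero_comp, comp_zero]
    have hc : (b • 𝟙 Y) ≫ cokernel.π f = 0 := by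
      rw [Linear.smul_comp, Category.id_comp, ← Category.comp_id (cokernel.π f),
        ← Linear.comp_smul, h₂ b hb, comp_zero]
    obtain ⟨h, hh⟩ : ∃ h, Abelian.factorThruImage f ≫ h = a • 𝟙 X :=
      ⟨_, Abelian.comp_epiDesc _ _ hk⟩
    obtain ⟨k, hk'⟩ : ∃ k, k ≫ Abelian.image.ι f = b • 𝟙 Y := ⟨_, kernel.lift_ι _ _ hc⟩
    have e₁ : Abelian.image.ι f ≫ k = b • 𝟙 _ := by
      rw [← cancel_mono (Abelian.image.ι f), Category.assoc, hk', Linear.comp_smul,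
        Linear.smul_comp, Category.comp_id, Category.id_comp]
    have e₂ : h ≫ Abelian.factorThruImage f = a • 𝟙 _ := by
      rw [← cancel_epi (Abelian.factorThruImage f), reassoc_of% hh, Linear.comp_smul,
        Linear.smul_comp, Category.comp_id, Category.id_comp]
    have fac := Abelian.image.fac f
    refine ⟨k ≫ h, ?_, ?_⟩
    · conv_lhs => enter [1]; rw [← fac]
      rw [Category.assoc, reassoc_of% e₁, Linear.smul_comp,
        Category.id_comp, Linear.comp_smul, hh, smul_smul, mul_comm]
    · conv_lhs => enter [2]; rw [← fac]
      rw [Category.assoc, reassoc_of% e₂, Linear.smul_comp,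
        Category.id_comp, Linear.comp_smul, hk', smul_smul]
  · intro H
    refine ⟨alphaNull_of_mul m D fun a ha b hb => ?_, alphaNull_of_mul m D fun a ha b hb => ?_⟩
    · obtain ⟨g, h₁, _⟩ := H a ha b hb
      rw [← cancel_mono (kernel.ι f), Linear.smul_comp, Category.id_comp,
        ← Category.comp_id (kernel.ι f), ← Linear.comp_smul, ← h₁, kernel.condition_assoc,
        zero_comp, zero_comp]
    · obtain ⟨g, _, h₂⟩ := H a ha b hb
      rw [← cancel_epi (cokernel.π f), Linear.comp_smul, Category.comp_id,
        ← Category.id_comp (cokernel.π f), ← Linear.smul_comp, ← h₂, Category.assoc,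
        cokernel.condition, comp_zero, comp_zero]

variable (D)
variable [MonoidalCategory D] [SymmetricCategory D] [MonoidalPreadditive D] [MonoidalLinear R D]
  [∀ X : D, PreservesFiniteColimits (tensorLeft X)] [Fact (IsIdempotentElem m)]

instance alphaIso_isMonoidal : (alphaIso m D).IsMonoidal where
  whiskerLeft X _ _ g hg := by
    rw [alphaIso_iff] at hg ⊢
    intro a ha b hb
    obtain ⟨h, h₁, h₂⟩ := hg a ha b hb
    refine ⟨X ◁ h, ?_, ?_⟩
    · rw [← MonoidalCategory.whiskerLeft_comp, h₁, MonoidalLinear.whiskerLeft_smul,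
        MonoidalCategory.whiskerLeft_id]
    · rw [← MonoidalCategory.whiskerLeft_comp, h₂, MonoidalLinear.whiskerLeft_smul,
        MonoidalCategory.whiskerLeft_id]
  whiskerRight f hf Y := by
    rw [alphaIso_iff] at hf ⊢
    intro a ha b hb
    obtain ⟨h, h₁, h₂⟩ := hf a ha b hb
    refine ⟨h ▷ Y, ?_, ?_⟩
    · rw [← comp_whiskerRight, h₁, MonoidalLinear.smul_whiskerRight, id_whiskerRight]
    · rw [← comp_whiskerRight, h₂, MonoidalLinear.smul_whiskerRight, id_whiskerRight]

/-- The category `α-D` of `α`-objects of `D`: the quotient of `D` by the Serre class of `α`-null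
objects, that is, the localization of `D` with respect to the `α`-isomorphisms. It is equipped
with the induced symmetric monoidal structure. -/
def Alpha : Type w :=
  LocalizedMonoidal (alphaIso m D).Q (alphaIso m D) (Iso.refl ((alphaIso m D).Q.obj (𝟙_ D)))

noncomputable instance alphaCategory : Category.{max w v} (Alpha m D) :=
  inferInstanceAs (Category (LocalizedMonoidal (alphaIso m D).Q (alphaIso m D)
    (Iso.refl ((alphaIso m D).Q.obj (𝟙_ D)))))

noncomputable instance alphaMonoidalCategory : MonoidalCategory (Alpha m D) :=
  inferInstanceAs (MonoidalCategory (LocalizedMonoidal (alphaIso m D).Q (alphaIso m D)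
    (Iso.refl ((alphaIso m D).Q.obj (𝟙_ D)))))

noncomputable instance alphaSymmetricCategory : SymmetricCategory (Alpha m D) :=
  inferInstanceAs (SymmetricCategory (LocalizedMonoidal (alphaIso m D).Q (alphaIso m D)
    (Iso.refl ((alphaIso m D).Q.obj (𝟙_ D)))))

/-- The localization functor `α : D ⥤ α-D`. -/
noncomputable def toAlpha : D ⥤ Alpha m D :=
  Localization.Monoidal.toMonoidalCategory (alphaIso m D).Q (alphaIso m D) (Iso.refl _)

instance toAlpha_isLocalization : (toAlpha m D).IsLocalization (alphaIso m D) :=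
  inferInstanceAs ((alphaIso m D).Q.IsLocalization (alphaIso m D))

noncomputable instance toAlpha_braided : (toAlpha m D).Braided :=
  inferInstanceAs ((Localization.Monoidal.toMonoidalCategory (alphaIso m D).Q (alphaIso m D)
    (Iso.refl _)).Braided)

/-- The preadditive structure on `α-D`. -/
@[reducible]
noncomputable def alphaPreadditive : Preadditive (Alpha m D) :=
  inferInstanceAs (Preadditive (alphaIso m D).Localization)

lemma toAlpha_additive_aux : letI := alphaPreadditive m D; (toAlpha m D).Additive :=
  inferInstanceAs ((alphaIso m D).Q.Additive)

noncomputable instance alphaAbelian : Abelian (Alpha m D) :=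
  letI := alphaPreadditive m D
  have := toAlpha_additive_aux m D
  ObjectProperty.SerreClassLocalization.abelian (toAlpha m D) (alphaNull R m D)

instance toAlpha_additive : (toAlpha m D).Additive := toAlpha_additive_aux m D

instance toAlpha_preservesFiniteLimits : PreservesFiniteLimits (toAlpha m D) :=
  ObjectProperty.SerreClassLocalization.preservesFiniteLimits (toAlpha m D) (alphaNull R m D)

instance toAlpha_preservesFiniteColimits : PreservesFiniteColimits (toAlpha m D) :=
  ObjectProperty.SerreClassLocalization.preservesFiniteColimits (toAlpha m D) (alphaNull R m D)

/-- The functor `α` commutes with tensor products. -/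
noncomputable def toAlphaTensorLeftIso (X : D) :
    toAlpha m D ⋙ tensorLeft ((toAlpha m D).obj X) ≅ tensorLeft X ⋙ toAlpha m D :=
  NatIso.ofComponents (fun Y => Functor.Monoidal.μIso (toAlpha m D) X Y) (by
    intro Y Z f
    exact Functor.LaxMonoidal.μ_natural_right (toAlpha m D) X f)

instance alpha_tensorLeft_preservesFiniteColimits (X : Alpha m D) :
    PreservesFiniteColimits (tensorLeft X) := by
  have h (Y : D) : PreservesFiniteColimits (tensorLeft ((toAlpha m D).obj Y)) := by
    rw [← ObjectProperty.SerreClassLocalization.preservesFiniteColimits_comp_iff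
      (toAlpha m D) (alphaNull R m D)]
    exact ⟨fun J _ _ => preservesColimitsOfShape_of_natIso (toAlphaTensorLeftIso m D Y).symm⟩
  have : (toAlpha m D).EssSurj := Localization.essSurj (toAlpha m D) (alphaIso m D)
  have := h ((toAlpha m D).objPreimage X)
  exact ⟨fun J _ _ => preservesColimitsOfShape_of_natIso
    ((tensoringLeft _).mapIso ((toAlpha m D).objObjPreimageIso X))⟩

instance alpha_monoidalPreadditive : MonoidalPreadditive (Alpha m D) :=
  monoidalPreadditive_of_rightExact _

end Almost

end AlmostDeformation

namespace AlmostDeformation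

section Sheaves

universe u

variable (C : Type u) [SmallCategory C] (J : GrothendieckTopology C) (R : Type u) [CommRing R]

/-- The category of sheaves of `R`-modules on a site, that is, of modules over the constant sheaf
of rings with value `R` on the topos of sheaves on the site. -/
def SheafMod : Type (u + 1) := Sheaf J (ModuleCat.{u} R)

noncomputable instance sheafCategory : Category.{u} (SheafMod C J R) :=
  inferInstanceAs (Category (Sheaf J (ModuleCat.{u} R)))

noncomputable instance sheafAbelian : Abelian (SheafMod C J R) :=
  inferInstanceAs (Abelian (Sheaf J (ModuleCat.{u} R)))

noncomputable instance sheafLinear : Linear R (SheafMod C J R) :=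
  inferInstanceAs (Linear R (Sheaf J (ModuleCat.{u} R)))

variable {C}

section

open scoped MonoidalClosed MonoidalClosed.FunctorCategory

instance w_isMonoidal : (J.W (A := ModuleCat.{u} R)).IsMonoidal :=
  have _ (F₁ F₂ : Cᵒᵖ ⥤ ModuleCat.{u} R) :
    Enriched.FunctorCategory.HasEnrichedHom (ModuleCat.{u} R) F₁ F₂ := inferInstance
  have _ (F₁ F₂ : Cᵒᵖ ⥤ ModuleCat.{u} R) :
    Enriched.FunctorCategory.HasFunctorEnrichedHom (ModuleCat.{u} R) F₁ F₂ := inferInstance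
  GrothendieckTopology.W.monoidal

/-- The sheafification functor. -/
noncomputable def sheafify : (Cᵒᵖ ⥤ ModuleCat.{u} R) ⥤ SheafMod C J R :=
  presheafToSheaf J (ModuleCat.{u} R)

/-- The inclusion of sheaves into presheaves. -/
noncomputable def toPresheaf : SheafMod C J R ⥤ (Cᵒᵖ ⥤ ModuleCat.{u} R) :=
  sheafToPresheaf J (ModuleCat.{u} R)

/-- The sheafification adjunction. -/
noncomputable def sheafifyAdj : sheafify J R ⊣ toPresheaf J R :=
  sheafificationAdjunction J (ModuleCat.{u} R)

/-- The tensor product of sheaves of modules: the sheaf associated with the tensor product of the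
underlying presheaves. -/
noncomputable instance sheafMonoidal : MonoidalCategory (SheafMod C J R) :=
  Sheaf.monoidalCategory J _

noncomputable instance sheafSymmetric : SymmetricCategory (SheafMod C J R) :=
  Sheaf.symmetricCategory J _

noncomputable instance sheafify_monoidal : (sheafify J R).Monoidal :=
  letI := Sheaf.monoidalCategory J (ModuleCat.{u} R)
  inferInstanceAs (presheafToSheaf J (ModuleCat.{u} R)).Monoidal

instance toPresheaf_full : (toPresheaf J R).Full :=
  inferInstanceAs (sheafToPresheaf J (ModuleCat.{u} R)).Full

instance toPresheaf_faithful : (toPresheaf J R).Faithful :=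
  inferInstanceAs (sheafToPresheaf J (ModuleCat.{u} R)).Faithful

instance sheaf_tensorLeft_isLeftAdjoint (X : SheafMod C J R) : (tensorLeft X).IsLeftAdjoint :=
  letI : MonoidalClosed (SheafMod C J R) :=
    Monoidal.Reflective.monoidalClosed (sheafifyAdj J R)
  inferInstance

end

instance sheaf_tensorLeft_preserves (X : SheafMod C J R) :
    PreservesFiniteColimits (tensorLeft X) where
  preservesFiniteColimits _ _ _ := inferInstance

instance sheaf_monoidalPreadditive : MonoidalPreadditive (SheafMod C J R) :=
  monoidalPreadditive_of_rightExact _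

lemma sheafify_smul (r : R) (Q : Cᵒᵖ ⥤ ModuleCat.{u} R) :
    (sheafify J R).map (r • 𝟙 Q) = r • 𝟙 _ := by
  apply ((sheafifyAdj J R).homEquiv _ _).injective
  rw [Adjunction.homEquiv_unit, Adjunction.homEquiv_unit]
  have h := (sheafifyAdj J R).unit.naturality (r • 𝟙 Q)
  change (r • 𝟙 Q) ≫ _ = _ ≫ (toPresheaf J R).map ((sheafify J R).map (r • 𝟙 Q)) at h
  rw [← h, show (toPresheaf J R).map (r • 𝟙 ((sheafify J R).obj Q)) = r • 𝟙 _ from rfl,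
    Linear.smul_comp, Linear.comp_smul, Category.id_comp]
  exact congrArg (fun t => r • t) (Category.comp_id _).symm

lemma presheaf_whiskerLeft_smul (r : R) (P Q : Cᵒᵖ ⥤ ModuleCat.{u} R) :
    P ◁ (r • 𝟙 Q) = r • 𝟙 (P ⊗ Q) := by
  ext X : 2
  change P.obj X ◁ (r • 𝟙 (Q.obj X)) = r • 𝟙 _
  rw [MonoidalLinear.whiskerLeft_smul, MonoidalCategory.whiskerLeft_id]
  rfl

instance sheaf_monoidalLinear : MonoidalLinear R (SheafMod C J R) := by
  let L := sheafify J R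
  have h₁ (r : R) (P Q : Cᵒᵖ ⥤ ModuleCat.{u} R) : L.obj P ◁ (r • 𝟙 (L.obj Q)) = r • 𝟙 _ := by
    rw [← cancel_mono (Functor.LaxMonoidal.μ L P Q), ← sheafify_smul,
      Functor.LaxMonoidal.μ_natural_right, presheaf_whiskerLeft_smul, sheafify_smul,
      Linear.comp_smul, Linear.smul_comp, Category.comp_id, Category.id_comp]
  have h₂ (r : R) (X Y : SheafMod C J R) : X ◁ (r • 𝟙 Y) = r • 𝟙 (X ⊗ Y) := by
    obtain ⟨P, ⟨e⟩⟩ : ∃ P, Nonempty (L.obj P ≅ X) :=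
      ⟨(toPresheaf J R).obj X, ⟨asIso ((sheafifyAdj J R).counit.app X)⟩⟩
    obtain ⟨Q, ⟨e'⟩⟩ : ∃ Q, Nonempty (L.obj Q ≅ Y) :=
      ⟨(toPresheaf J R).obj Y, ⟨asIso ((sheafifyAdj J R).counit.app Y)⟩⟩
    have h : e'.hom ≫ (r • 𝟙 Y) = (r • 𝟙 _) ≫ e'.hom := by
      rw [Linear.comp_smul, Linear.smul_comp, Category.comp_id, Category.id_comp]
    rw [← cancel_epi (e.hom ▷ Y), ← cancel_epi (L.obj P ◁ e'.hom), ← whisker_exchange,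
      ← MonoidalCategory.whiskerLeft_comp_assoc, h, MonoidalCategory.whiskerLeft_comp, h₁]
    simp only [Linear.comp_smul, Linear.smul_comp, Category.comp_id, Category.id_comp]
  have h₃ (r : R) (X : SheafMod C J R) {Y Z : SheafMod C J R} (f : Y ⟶ Z) :
      X ◁ (r • f) = r • (X ◁ f) := by
    rw [← Category.id_comp f, ← Linear.smul_comp, MonoidalCategory.whiskerLeft_comp, h₂,
      Linear.smul_comp, Category.id_comp, Category.id_comp]
  have h₄ {X Y Z : SheafMod C J R} (f : Y ⟶ Z) :
      f ▷ X = (β_ Y X).hom ≫ X ◁ f ≫ (β_ Z X).inv := by simp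
  exact
    { whiskerLeft_smul := fun X _ _ r f => h₃ r X f
      smul_whiskerRight := fun r _ _ f X => by
        rw [h₄, h₃, h₄, Linear.smul_comp, Linear.comp_smul] }

end Sheaves
end AlmostDeformation

namespace AlmostDeformation

section Ring

universe u

variable (p : ℕ) (OK : Type u) [CommRing OK] (Kbar : Type u) [Field Kbar] [Algebra OK Kbar]

/-- The `p`-adic completion `𝔬` of the integral closure of `OK` in `Kbar`. -/
abbrev CompletedIntegers : Type u :=
  AdicCompletion (Ideal.span {(p : integralClosure OK Kbar)}) (integralClosure OK Kbar)

lemma integralClosure_exists_sq [IsAlgClosed Kbar] (b : integralClosure OK Kbar) :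
    ∃ c : integralClosure OK Kbar, c * c = b := by
  obtain ⟨c, hc⟩ := IsAlgClosed.exists_pow_nat_eq (b : Kbar) (n := 2) two_pos
  have h : IsIntegral OK c := IsIntegral.of_pow two_pos (hc ▸ b.2)
  exact ⟨⟨c, h⟩, Subtype.ext (by rw [← hc, sq]; rfl)⟩

/-- The maximal ideal `𝔪` of `𝔬` satisfies `𝔪² = 𝔪`. -/
instance completedIntegers_idempotent [IsAlgClosed Kbar]
    (m : Ideal (CompletedIntegers p OK Kbar)) [m.IsMaximal] : Fact (IsIdempotentElem m) := by
  refine ⟨le_antisymm Ideal.mul_le_right fun x hx => ?_⟩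
  set I : Ideal (integralClosure OK Kbar) := Ideal.span {(p : integralClosure OK Kbar)}
  have hI : I.FG := ⟨{(p : integralClosure OK Kbar)}, by simp [I]⟩
  have hc := AdicCompletion.isAdicComplete_self I hI
  let f : integralClosure OK Kbar →+* AdicCompletion I (integralClosure OK Kbar) :=
    algebraMap _ _
  have hIm : I.map f ≤ m :=
    (IsAdicComplete.le_jacobson_bot (I.map f)).trans (sInf_le ⟨bot_le, inferInstance⟩)
  have hsq (b : integralClosure OK Kbar) (hb : f b ∈ m) : f b ∈ m * m := by
    obtain ⟨c, rfl⟩ := integralClosure_exists_sq OK Kbar b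
    rw [map_mul] at hb ⊢
    have hc : f c ∈ m := (Ideal.IsMaximal.isPrime ‹_›).mem_or_mem hb |>.elim id id
    exact Ideal.mul_mem_mul hc hc
  have hIm2 : I.map f ≤ m * m := by
    rw [Ideal.map_span, Ideal.span_le]
    rintro _ ⟨b, hb, rfl⟩
    exact hsq b (hIm (Ideal.mem_map_of_mem f (Ideal.subset_span hb)))
  obtain ⟨y, hy⟩ := Ideal.Quotient.mk_surjective (AdicCompletion.evalOneₐ I x)
  have hxy : x - f y ∈ I.map f := by
    rw [← AdicCompletion.ker_evalOneₐ_eq_map I hI, RingHom.mem_ker, map_sub, sub_eq_zero]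
    exact hy.symm
  have hfy : f y ∈ m := by
    have := m.sub_mem hx (hIm hxy)
    rwa [sub_sub_cancel] at this
  have := (m * m).add_mem (hIm2 hxy) (hsq y hfy)
  rwa [sub_add_cancel] at this

end Ring

end AlmostDeformation

namespace AlmostDeformation

/-- The square zero extension `A^α ⟶ A₀^α` of monoids of `α`-objects induced by a square zero
extension `A ⟶ A₀`. -/
noncomputable abbrev SquareZeroExtension.alpha {R : Type*} [CommRing R] {D : Type*} [Category D]
    [Abelian D] [Linear R D] [MonoidalCategory D] [SymmetricCategory D] [MonoidalPreadditive D]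
    [MonoidalLinear R D] [∀ X : D, PreservesFiniteColimits (tensorLeft X)]
    (S : SquareZeroExtension D) (m : Ideal R) [Fact (IsIdempotentElem m)] :
    SquareZeroExtension (Alpha m D) :=
  S.map (toAlpha m D)

end AlmostDeformation

open AlmostDeformation

universe u

/-! The argument takes place in any abelian symmetric monoidal category with right exact tensor
product. It rests on the sequence 0 → Ext¹_{A₀}(M₀,J) → Ext¹_A(M₀,J) → Hom_{A₀}(I ⊗_{A₀} M₀, J),
whose last map is u. The sequence is exact because u(E) = 0 says that I kills the middle term of E,
and an A-module killed by I is the same thing as an A₀-module (`resExt_injective`,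
`exists_resExt_eq`).

The map u need not be surjective, but every target is reached after enlarging J
(`exists_extension_mono_u`). Choose an epimorphism X → M₀ such that I ⊗ X → A ⊗ X is mono, put P = A
⊗ X and let N be the kernel of P → M₀. The extension 0 → N/IN → P/IN → M₀ → 0 has injective u, whose
image is IP/IN.

Embed I ⊗_{A₀} M₀ into K = N/IN by this u, with cokernel R. The pushed class in Ext¹_A(M₀,R) has u =
0, so it comes from some e over A₀. Its image under the connecting map is a class θ in Ext²_{A₀}(M₀,
I ⊗_{A₀} M₀), and ∂(u₀) is the image of θ under u₀, which makes additivity immediate. The choices do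
not matter: two extensions with equal u differ by a class over A₀ with values in the middle term,
which the connecting map kills (`connecting_eq_of_u_eq`, `connecting_comp`).

If ∂(u₀) = 0, then e lifts to a class over A₀ in the middle term. Subtracting it leaves u unchanged
and makes the extension come from J (`IsConnecting.exists_extension`). The torsor statement is
exactness again, read on classes.

The objects X come from flat sheaves associated with presheaves of free modules. They pass to
α-sheaves because the quotient functor is exact, monoidal and essentially surjective. -/

namespace AlmostDeformation

/-! ### Classes in Ext¹ as short exact sequences -/

section YonedaExt

open CategoryTheory.Abelian Pretriangulated DerivedCategory

universe w' w v

variable {C : Type u} [Category.{v} C] [Abelian C]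

/-- An extension in the derived category of objects of an abelian category, placed in degree `0`,
comes from a short exact sequence. -/
lemma exists_shortExact_of_distTriang [HasDerivedCategory.{w'} C] {X Y : C}
    {Z : DerivedCategory C} (a : (singleFunctor C 0).obj Y ⟶ Z)
    (b : Z ⟶ (singleFunctor C 0).obj X)
    (c : (singleFunctor C 0).obj X ⟶ ((singleFunctor C 0).obj Y)⟦(1 : ℤ)⟧)
    (hT : Triangle.mk a b c ∈ distTriang (DerivedCategory C)) :
    ∃ (M : C) (f : Y ⟶ M) (g : M ⟶ X) (zero : f ≫ g = 0)
      (h : (ShortComplex.mk f g zero).ShortExact), h.singleδ = c := by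
  have hE (n : ℤ) : (ShortComplex.mk ((homologyFunctor C n).map a)
      ((homologyFunctor C n).map b) _).Exact := HomologySequence.exact₂ _ hT n
  -- The homology of `Z` in degree i sits between those of `Y` and `X`, so it vanishes for i ≠ 0.
  -- Hence `Z` is an object `M` placed in degree 0.
  have : Z.IsGE 0 := by
    rw [isGE_iff]
    intro i hi
    exact (hE i).isZero_X₂ ((isZero_of_isGE _ 0 i hi).eq_of_src _ _)
      ((isZero_of_isGE _ 0 i hi).eq_of_tgt _ _)
  have : Z.IsLE 0 := by
    rw [isLE_iff]
    intro i hi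
    exact (hE i).isZero_X₂ ((isZero_of_isLE _ 0 i hi).eq_of_src _ _)
      ((isZero_of_isLE _ 0 i hi).eq_of_tgt _ _)
  obtain ⟨M, ⟨e⟩⟩ := exists_iso_singleFunctor_obj_of_isGE_of_isLE Z 0
  obtain ⟨f, hf⟩ := (singleFunctor C 0).map_surjective (a ≫ e.hom)
  obtain ⟨g, hg⟩ := (singleFunctor C 0).map_surjective (e.inv ≫ b)
  have h₁ : (singleFunctor C 0).map f ≫ e.inv = 𝟙 _ ≫ a := by simp [hf]
  have h₂ : (singleFunctor C 0).map g ≫ 𝟙 _ = e.inv ≫ b := by simp [hg]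
  have h₃ : c ≫ (𝟙 ((singleFunctor C 0).obj Y))⟦(1 : ℤ)⟧' = 𝟙 _ ≫ c := by simp
  have hT' : Triangle.mk ((singleFunctor C 0).map f) ((singleFunctor C 0).map g) c ∈
      distTriang (DerivedCategory C) :=
    isomorphic_distinguished _ hT _
      (Triangle.isoMk _ _ (Iso.refl _) e.symm (Iso.refl _) h₁ h₂ h₃)
  have zero : f ≫ g = 0 := (singleFunctor C 0).map_injective (by
    rw [Functor.map_comp, Functor.map_zero]; exact comp_distTriang_mor_zero₁₂ _ hT')
  let φ := singleFunctorCompHomologyFunctorIso C 0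
  have hex : (ShortComplex.mk f g zero).Exact := by
    refine ShortComplex.exact_of_iso ?_ (HomologySequence.exact₂ _ hT' 0)
    exact ShortComplex.isoMk (φ.app _) (φ.app _) (φ.app _)
      (φ.hom.naturality f).symm (φ.hom.naturality g).symm
  have hmono : Mono f := by
    have : Mono ((singleFunctor C 0 ⋙ homologyFunctor C 0).map f) :=
      (HomologySequence.mono_homologyMap_mor₁_iff _ hT' (-1) 0).2
        ((isZero_of_isGE ((singleFunctor C 0).obj X) 0 (-1) (by lia)).eq_of_src _ _)
    exact ((MorphismProperty.monomorphisms C).arrow_mk_iso_iff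
      (((Functor.mapArrowFunctor _ _).mapIso φ).app (Arrow.mk f))).1 this
  have hepi : Epi g := by
    have : Epi ((singleFunctor C 0 ⋙ homologyFunctor C 0).map g) :=
      (HomologySequence.epi_homologyMap_mor₂_iff _ hT' 0 1).2
        ((isZero_of_isLE ((singleFunctor C 0).obj Y) 0 1 (by lia)).eq_of_tgt _ _)
    exact ((MorphismProperty.epimorphisms C).arrow_mk_iso_iff
      (((Functor.mapArrowFunctor _ _).mapIso φ).app (Arrow.mk g))).1 this
  have h : (ShortComplex.mk f g zero).ShortExact := { exact := hex }
  refine ⟨M, f, g, zero, h, ?_⟩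
  -- Both triangles have first maps `f`, `g`. A comparison that is the identity on `Y` and `M` is
  -- some `t` on `X` with g ≫ t = g, so `t` is the identity and the connecting maps agree.
  obtain ⟨t, ht, ht'⟩ := complete_distinguished_triangle_morphism _ _
    h.singleTriangle_distinguished hT' (𝟙 _) (𝟙 _)
    ((Category.comp_id _).trans (Category.id_comp _).symm)
  obtain ⟨t, rfl⟩ := (singleFunctor C 0).map_surjective t
  have : t = 𝟙 X := by
    rw [← cancel_epi g, Category.comp_id]
    apply (singleFunctor C 0).map_injective
    rw [Functor.map_comp]
    exact ht.trans (Category.id_comp _)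
  subst this
  have ht'' : h.singleδ ≫ (𝟙 ((singleFunctor C 0).obj Y))⟦(1 : ℤ)⟧' =
    (singleFunctor C 0).map (𝟙 X) ≫ c := ht'
  simpa using ht''

variable [HasExt.{w} C]

/-- Every class in `Ext¹` is the class of a short exact sequence. -/
lemma exists_extClass_eq {X Y : C} (ξ : Ext.{w} X Y 1) :
    ∃ (M : C) (f : Y ⟶ M) (g : M ⟶ X) (zero : f ≫ g = 0)
      (h : (ShortComplex.mk f g zero).ShortExact), h.extClass = ξ := by
  let := HasDerivedCategory.standard C
  obtain ⟨Z, a, b, hT⟩ := distinguished_cocone_triangle₂ ξ.hom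
  obtain ⟨M, f, g, zero, h, hh⟩ := exists_shortExact_of_distTriang a b _ hT
  refine ⟨M, f, g, zero, h, ?_⟩
  ext
  rw [h.extClass_hom]
  exact hh

/-- If the class of an extension of `X` by `Y` is mapped by `b : Y ⟶ Y'` to the class of an
extension of `X` by `Y'`, then `b` extends to a morphism of extensions. -/
lemma exists_hom_of_extClass_comp {X Y Y' M M' : C} {f : Y ⟶ M} {g : M ⟶ X} {zero : f ≫ g = 0}
    (h : (ShortComplex.mk f g zero).ShortExact) {f' : Y' ⟶ M'} {g' : M' ⟶ X} {zero' : f' ≫ g' = 0}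
    (h' : (ShortComplex.mk f' g' zero').ShortExact) (b : Y ⟶ Y')
    (hb : h.extClass.comp (Ext.mk₀ b) (add_zero 1) = h'.extClass) :
    ∃ φ : M ⟶ M', f ≫ φ = b ≫ f' ∧ φ ≫ g' = g := by
  have := h.epi_g
  -- The obstruction to extending b ≫ f' along `f` is the class of the second extension composed
  -- with its own `f'`, which is zero.
  obtain ⟨ψ, hψ⟩ := Ext.contravariant_sequence_exact₁ h _ (Ext.mk₀ (b ≫ f')) (add_zero 1) (by
    rw [← Ext.mk₀_comp_mk₀, ← Ext.comp_assoc_of_third_deg_zero, hb]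
    exact h'.extClass_comp)
  obtain ⟨ψ, rfl⟩ := (Ext.mk₀_bijective _ _).2 ψ
  rw [Ext.mk₀_comp_mk₀] at hψ
  replace hψ : f ≫ ψ = b ≫ f' := (Ext.mk₀_bijective _ _).1 hψ
  -- `ψ` may induce an endomorphism `c` of `X` other than the identity. Naturality shows that c - 1
  -- kills the second class, so it lifts to d : X ⟶ M', and ψ - g ≫ d is the corrected map.
  let c : X ⟶ X := h.exact.desc (ψ ≫ g') (by
    change f ≫ ψ ≫ g' = 0
    rw [reassoc_of% hψ, zero', comp_zero])
  have hc : g ≫ c = ψ ≫ g' := h.exact.g_desc _ _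
  have hn := ShortComplex.ShortExact.extClass_naturality h h'
    { τ₁ := b, τ₂ := ψ, τ₃ := c, comm₁₂ := hψ.symm, comm₂₃ := hc.symm }
  have hn' : (Ext.mk₀ (c - 𝟙 X)).comp h'.extClass (zero_add 1) = 0 := by
    rw [sub_eq_add_neg, Ext.mk₀_add, Ext.mk₀_neg, Ext.add_comp, Ext.neg_comp, Ext.mk₀_id_comp,
      ← sub_eq_add_neg, sub_eq_zero]
    exact hn.symm.trans hb
  obtain ⟨d, hd⟩ := Ext.covariant_sequence_exact₃ _ h' _ (zero_add 1) hn'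
  obtain ⟨d, rfl⟩ := (Ext.mk₀_bijective _ _).2 d
  rw [Ext.mk₀_comp_mk₀] at hd
  replace hd : d ≫ g' = c - 𝟙 X := (Ext.mk₀_bijective _ _).1 hd
  refine ⟨ψ - g ≫ d, ?_, ?_⟩
  · rw [Preadditive.comp_sub, reassoc_of% zero, zero_comp, sub_zero, hψ]
  · rw [Preadditive.sub_comp, Category.assoc, hd, Preadditive.comp_sub, hc]
    simp

omit [HasExt.{w} C] in
/-- The push out of a short exact sequence. -/
lemma exists_shortExact_pushout {X Y Y' M : C} {f : Y ⟶ M} {g : M ⟶ X} {zero : f ≫ g = 0}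
    (h : (ShortComplex.mk f g zero).ShortExact) (b : Y ⟶ Y') :
    ∃ (M' : C) (f' : Y' ⟶ M') (g' : M' ⟶ X) (zero' : f' ≫ g' = 0) (φ : M ⟶ M'),
      (ShortComplex.mk f' g' zero').ShortExact ∧ IsPushout f b φ f' ∧ φ ≫ g' = g := by
  have : Mono f := h.mono_f
  have : Epi g := h.epi_g
  let g' : pushout f b ⟶ X := pushout.desc g 0 (by simp [zero])
  have hg : pushout.inl f b ≫ g' = g := pushout.inl_desc _ _ _
  have zero' : pushout.inr f b ≫ g' = 0 := pushout.inr_desc _ _ _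
  have : Epi g' := epi_of_epi_fac hg
  refine ⟨pushout f b, pushout.inr f b, g', zero', pushout.inl f b, ?_,
    IsPushout.of_hasPushout f b, hg⟩
  -- Monomorphisms are stable under pushout in an abelian category, which instance search supplies;
  -- it remains to see that `g'` is a cokernel.
  refine ⟨ShortComplex.exact_of_g_is_cokernel _ (CokernelCofork.IsColimit.ofπ' _ _
    (fun k hk => ?_))⟩
  change pushout.inr f b ≫ k = 0 at hk
  have h0 : f ≫ pushout.inl f b ≫ k = 0 := by rw [pushout.condition_assoc, hk, comp_zero]
  have h1 : g ≫ h.exact.desc (pushout.inl f b ≫ k) h0 = _ := h.exact.g_desc _ h0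
  refine ⟨h.exact.desc _ h0, pushout.hom_ext ?_ ?_⟩
  · rw [reassoc_of% hg, h1]
  · rw [reassoc_of% zero', hk, zero_comp]

end YonedaExt

end AlmostDeformation

/-! ### The invariant u as a natural homomorphism on Ext¹ over A -/

namespace AlmostDeformation

open CategoryTheory.Abelian

namespace SquareZeroExtension

universe v w

variable {D : Type w} [Category.{v} D] [MonoidalCategory D] [SymmetricCategory D] [Abelian D]
  [MonoidalPreadditive D] [∀ X : D, PreservesFiniteColimits (tensorLeft X)]
  {S : SquareZeroExtension D}

instance modTensorπ_epi {A : D} [MonObj A] [IsCommMonObj A] (M N : CategoryTheory.Mod D A) :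
    Epi (modTensorπ M N) :=
  inferInstanceAs (Epi ((Mod.forget A).map (coequalizer.π (tensorActFst M N) (tensorActSnd M N))))

namespace ModExtension

variable {M₀ J J' : CategoryTheory.Mod D S.A₀}

/-- The map `u` is compatible with morphisms of extensions. -/
lemma u_comp_of_hom {E : S.ModExtension M₀ J} {E' : S.ModExtension M₀ J'} (b : J ⟶ J')
    (φ : E.M ⟶ E'.M) (hf : E.f ≫ φ = S.res.map b ≫ E'.f) (hg : φ ≫ E'.g = E.g) :
    E.u ≫ b = E'.u := by
  have hi : E.i ≫ φ.hom = b.hom ≫ E'.i := congrArg Mod.Hom.hom hf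
  have hq : φ.hom ≫ E'.q = E.q := congrArg Mod.Hom.hom hg
  apply Mod.hom_ext
  -- Between this epimorphism and this monomorphism, both sides become multiplication by I followed
  -- by `φ`, since `φ` is linear.
  rw [← cancel_mono E'.i, ← cancel_epi (modTensorπ S.ideal M₀), ← cancel_epi (S.I ◁ E.q)]
  change S.I ◁ E.q ≫ modTensorπ S.ideal M₀ ≫ (E.u.hom ≫ b.hom) ≫ E'.i = _
  rw [Category.assoc, ← hi, ← Category.assoc E.u.hom, ← Category.assoc (modTensorπ _ _),
    ← Category.assoc (S.I ◁ E.q), u_spec, ← hq, MonoidalCategory.whiskerLeft_comp, Category.assoc, Category.assoc,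
    u_spec, act_hom, whisker_exchange_assoc]

/-- The push out of an extension along a morphism `J ⟶ J'`. -/
lemma exists_pushforward (E : S.ModExtension M₀ J) (b : J ⟶ J') :
    ∃ E' : S.ModExtension M₀ J', E'.u = E.u ≫ b ∧
      E'.extClass = E.extClass.comp (Ext.mk₀ (S.res.map b)) (add_zero 1) := by
  obtain ⟨M, f, g, zero, φ, h, sq, hg⟩ := exists_shortExact_pushout E.shortExact (S.res.map b)
  let E' : S.ModExtension M₀ J' := ⟨M, f, g, zero, h⟩
  refine ⟨E', (u_comp_of_hom (E := E) (E' := E') b φ sq.w hg).symm, ?_⟩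
  have := ShortComplex.ShortExact.extClass_naturality E.shortExact h
    { τ₁ := S.res.map b, τ₂ := φ, τ₃ := 𝟙 _, comm₁₂ := sq.w.symm
      comm₂₃ := by simpa using hg }
  rw [Ext.mk₀_id_comp] at this
  exact this.symm

/-- The map `u` only depends on the class of the extension, and it is natural in `J`. -/
lemma u_comp_of_extClass {E : S.ModExtension M₀ J} {E' : S.ModExtension M₀ J'} (b : J ⟶ J')
    (h : E.extClass.comp (Ext.mk₀ (S.res.map b)) (add_zero 1) = E'.extClass) :
    E.u ≫ b = E'.u := by
  obtain ⟨φ, hf, hg⟩ := exists_hom_of_extClass_comp E.shortExact E'.shortExact (S.res.map b) h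
  exact u_comp_of_hom b φ hf hg

lemma exists_extClass_eq (ξ : Ext.{max w v} (S.res.obj M₀) (S.res.obj J) 1) :
    ∃ E : S.ModExtension M₀ J, E.extClass = ξ := by
  obtain ⟨M, f, g, zero, h, hξ⟩ := AlmostDeformation.exists_extClass_eq ξ
  exact ⟨⟨M, f, g, zero, h⟩, hξ⟩

/-- Extensions with the same class are isomorphic. -/
lemma exists_iso_of_extClass_eq {E E' : S.ModExtension M₀ J} (h : E.extClass = E'.extClass) :
    ∃ e : E.M ≅ E'.M, E.f ≫ e.hom = E'.f ∧ e.hom ≫ E'.g = E.g := by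
  obtain ⟨φ, hf, hg⟩ := exists_hom_of_extClass_comp E.shortExact E'.shortExact (𝟙 _)
    (by rw [Ext.comp_mk₀_id]; exact h)
  rw [Category.id_comp] at hf
  let ψ : ShortComplex.mk E.f E.g E.zero ⟶ ShortComplex.mk E'.f E'.g E'.zero :=
    { τ₁ := 𝟙 _, τ₂ := φ, τ₃ := 𝟙 _
      comm₁₂ := by simpa using hf.symm
      comm₂₃ := by simpa using hg }
  have : IsIso φ := by
    have : IsIso ψ.τ₁ := inferInstanceAs (IsIso (𝟙 _))
    have : IsIso ψ.τ₃ := inferInstanceAs (IsIso (𝟙 _))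
    exact ShortComplex.isIso₂_of_shortExact_of_isIso₁₃ ψ E.shortExact E'.shortExact
  exact ⟨asIso φ, hf, hg⟩

end ModExtension

variable (S) in
/-- The homomorphism `Ext¹_A(M₀, J) ⟶ Hom_{A₀}(I ⊗_{A₀} M₀, J)` that sends the class of an
extension `E` to `u(E)`. -/
noncomputable def uExt (M₀ J : CategoryTheory.Mod D S.A₀) :
    Ext.{max w v} (S.res.obj M₀) (S.res.obj J) 1 →+ (modTensor S.ideal M₀ ⟶ J) :=
  AddMonoidHom.mk' (fun ξ => (ModExtension.exists_extClass_eq ξ).choose.u) (by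
    intro x y
    generalize hx : ModExtension.exists_extClass_eq x = hx'
    generalize hy : ModExtension.exists_extClass_eq y = hy'
    generalize hxy : ModExtension.exists_extClass_eq (x + y) = hxy'
    -- `F` has class (x, y) in J ⊞ J. Its two projections have classes x and y and its image under
    -- the codiagonal has class x + y, so additivity follows from naturality of u, the codiagonal
    -- being fst + snd.
    obtain ⟨F, hF⟩ := ModExtension.exists_extClass_eq
      (x.comp (Ext.mk₀ (S.res.map (biprod.inl : J ⟶ J ⊞ J))) (add_zero 1) +
        y.comp (Ext.mk₀ (S.res.map (biprod.inr : J ⟶ J ⊞ J))) (add_zero 1))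
    have h₁ : F.u ≫ biprod.fst = hx'.choose.u := ModExtension.u_comp_of_extClass _ (by
      rw [hx'.choose_spec, hF, Ext.add_comp, Ext.comp_assoc_of_third_deg_zero,
        Ext.comp_assoc_of_third_deg_zero, Ext.mk₀_comp_mk₀, Ext.mk₀_comp_mk₀, ← S.res.map_comp,
        ← S.res.map_comp, biprod.inl_fst, biprod.inr_fst]
      simp)
    have h₂ : F.u ≫ biprod.snd = hy'.choose.u := ModExtension.u_comp_of_extClass _ (by
      rw [hy'.choose_spec, hF, Ext.add_comp, Ext.comp_assoc_of_third_deg_zero,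
        Ext.comp_assoc_of_third_deg_zero, Ext.mk₀_comp_mk₀, Ext.mk₀_comp_mk₀, ← S.res.map_comp,
        ← S.res.map_comp, biprod.inl_snd, biprod.inr_snd]
      simp)
    have h₃ : F.u ≫ biprod.desc (𝟙 _) (𝟙 _) = hxy'.choose.u := ModExtension.u_comp_of_extClass _ (by
      rw [hxy'.choose_spec, hF, Ext.add_comp, Ext.comp_assoc_of_third_deg_zero,
        Ext.comp_assoc_of_third_deg_zero, Ext.mk₀_comp_mk₀, Ext.mk₀_comp_mk₀, ← S.res.map_comp,
        ← S.res.map_comp, biprod.inl_desc, biprod.inr_desc]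
      simp)
    rw [← h₁, ← h₂, ← h₃, ← Preadditive.comp_add]
    congr 1
    apply biprod.hom_ext' <;> simp)

lemma uExt_extClass {M₀ J : CategoryTheory.Mod D S.A₀} (E : S.ModExtension M₀ J) :
    S.uExt M₀ J E.extClass = E.u := by
  have h := (ModExtension.exists_extClass_eq E.extClass).choose_spec
  have := ModExtension.u_comp_of_extClass (𝟙 J) (by rw [h]; simp :
    (ModExtension.exists_extClass_eq E.extClass).choose.extClass.comp
      (Ext.mk₀ (S.res.map (𝟙 J))) (add_zero 1) = E.extClass)
  rw [Category.comp_id] at this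
  exact this

lemma uExt_comp {M₀ J J' : CategoryTheory.Mod D S.A₀}
    (ξ : Ext.{max w v} (S.res.obj M₀) (S.res.obj J) 1) (b : J ⟶ J') :
    S.uExt M₀ J' (ξ.comp (Ext.mk₀ (S.res.map b)) (add_zero 1)) = S.uExt M₀ J ξ ≫ b := by
  obtain ⟨E, rfl⟩ := ModExtension.exists_extClass_eq ξ
  obtain ⟨E', h, h'⟩ := E.exists_pushforward b
  rw [← h', uExt_extClass, uExt_extClass, h]

end SquareZeroExtension

end AlmostDeformation

/-! ### Exactness of 0 → Ext¹ over A₀ → Ext¹ over A → Hom -/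

namespace AlmostDeformation

open CategoryTheory.Abelian

namespace SquareZeroExtension

universe v w

variable {D : Type w} [Category.{v} D] [MonoidalCategory D] [SymmetricCategory D] [Abelian D]
  [MonoidalPreadditive D] [∀ X : D, PreservesFiniteColimits (tensorLeft X)]
  (S : SquareZeroExtension D)

/-- Linearity over A₀ can be tested after precomposing with the epimorphism A ⊗ X → A₀ ⊗ X. -/
instance res_full : S.res.Full where
  map_surjective {X Y} h := by
    refine ⟨mkHom h.hom ?_, rfl⟩
    let k : X.X ⟶ Y.X := h.hom
    have hk : (S.p ▷ X.X ≫ act X) ≫ k = S.A ◁ k ≫ S.p ▷ Y.X ≫ act Y := act_hom h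
    rw [whisker_exchange_assoc, Category.assoc] at hk
    exact (cancel_epi (S.p ▷ X.X)).1 hk

instance res_faithful : S.res.Faithful where
  map_injective {X Y _ _} h :=
    Mod.hom_ext _ _ (congrArg (fun k : S.res.obj X ⟶ S.res.obj Y => k.hom) h)

/-- An `A`-module annihilated by the ideal `I` is an `A₀`-module. -/
lemma exists_res_iso (M : CategoryTheory.Mod D S.A) (hM : S.ι ▷ M.X ≫ act M = 0) :
    ∃ N : CategoryTheory.Mod D S.A₀, Nonempty (S.res.obj N ≅ M) := by
  -- By right exactness A₀ ⊗ M is the cokernel of I ⊗ M → A ⊗ M, so the action descends. Its axioms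
  -- are then checked on A ⊗ M and A ⊗ A ⊗ M.
  obtain ⟨a, ha⟩ := exists_whiskerRight_desc M.X S.shortExact (act M) hM
  change S.p ▷ M.X ≫ a = act M at ha
  have : Epi (S.p ⊗ₘ S.p) := by
    rw [MonoidalCategory.tensorHom_def]
    infer_instance
  let N : CategoryTheory.Mod D S.A₀ := mkMod M.X a
    (by rw [← IsMonHom.one_hom S.p, comp_whiskerRight, Category.assoc, ha, one_act])
    (by
      rw [← cancel_epi ((S.p ⊗ₘ S.p) ▷ M.X), ← comp_whiskerRight_assoc, ← IsMonHom.mul_hom,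
        comp_whiskerRight_assoc, ha, mul_act, MonoidalCategory.tensorHom_def,
        comp_whiskerRight_assoc, associator_naturality_middle_assoc,
        associator_naturality_left_assoc, ← MonoidalCategory.whiskerLeft_comp_assoc S.A₀, ha,
        ← whisker_exchange_assoc, ha])
  let f : S.res.obj N ⟶ M := mkHom (𝟙 M.X) (by
    change (S.p ▷ M.X ≫ a) ≫ 𝟙 M.X = S.A ◁ 𝟙 M.X ≫ act M
    rw [ha]; simp)
  have : IsIso ((Mod.forget S.A).map f) := inferInstanceAs (IsIso (𝟙 M.X))
  have : IsIso f := isIso_of_reflects_iso f (Mod.forget S.A)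
  exact ⟨N, ⟨asIso f⟩⟩

variable {S}

/-- Multiplication by I on the middle term is `E.u` preceded by an epimorphism and followed by a
monomorphism. -/
lemma ModExtension.u_eq_zero_iff {M₀ J : CategoryTheory.Mod D S.A₀} (E : S.ModExtension M₀ J) :
    E.u = 0 ↔ S.ι ▷ E.M.X ≫ act E.M = 0 := by
  rw [← E.u_spec]
  constructor
  · intro h
    have h' : E.u.hom = 0 := congrArg Mod.Hom.hom h
    rw [h']
    simp
  · intro h
    apply Mod.hom_ext
    rw [← cancel_mono E.i, ← cancel_epi (modTensorπ S.ideal M₀), ← cancel_epi (S.I ◁ E.q), h]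
    change 0 = S.I ◁ E.q ≫ modTensorπ S.ideal M₀ ≫ 0 ≫ E.i
    simp

/-- A short exact sequence of `A₀`-modules, as an extension of `A`-modules. -/
noncomputable def ModExtension.ofShortExact {M₀ J M : CategoryTheory.Mod D S.A₀} {f : J ⟶ M}
    {g : M ⟶ M₀} {zero : f ≫ g = 0} (h : (ShortComplex.mk f g zero).ShortExact) :
    S.ModExtension M₀ J :=
  ⟨S.res.obj M, S.res.map f, S.res.map g, by rw [← S.res.map_comp, zero, S.res.map_zero],
    h.map_of_exact S.res⟩

lemma ModExtension.ofShortExact_u {M₀ J M : CategoryTheory.Mod D S.A₀} {f : J ⟶ M}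
    {g : M ⟶ M₀} {zero : f ≫ g = 0} (h : (ShortComplex.mk f g zero).ShortExact) :
    (ofShortExact h).u = 0 := by
  rw [u_eq_zero_iff]
  change S.ι ▷ M.X ≫ S.p ▷ M.X ≫ (act M : S.A₀ ⊗ M.X ⟶ M.X) = (0 : S.I ⊗ M.X ⟶ M.X)
  rw [← comp_whiskerRight_assoc, S.zero]
  simp

lemma ModExtension.ofShortExact_extClass {M₀ J M : CategoryTheory.Mod D S.A₀} {f : J ⟶ M}
    {g : M ⟶ M₀} {zero : f ≫ g = 0} (h : (ShortComplex.mk f g zero).ShortExact) :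
    (ofShortExact h).extClass = S.resExt M₀ J 1 h.extClass :=
  (Ext.mapExactFunctor_extClass S.res h).symm

lemma uExt_resExt {M₀ J : CategoryTheory.Mod D S.A₀} (e : Ext.{max w v} M₀ J 1) :
    S.uExt M₀ J (S.resExt M₀ J 1 e) = 0 := by
  obtain ⟨M, f, g, zero, h, rfl⟩ := exists_extClass_eq e
  rw [← ModExtension.ofShortExact_extClass, uExt_extClass, ModExtension.ofShortExact_u]

/-- Exactness in the middle: when u vanishes, I kills the middle term, so the whole extension
descends along the fully faithful exact functor `S.res`. -/
lemma exists_resExt_eq {M₀ J : CategoryTheory.Mod D S.A₀}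
    (ξ : Ext.{max w v} (S.res.obj M₀) (S.res.obj J) 1) (hξ : S.uExt M₀ J ξ = 0) :
    ∃ e : Ext.{max w v} M₀ J 1, S.resExt M₀ J 1 e = ξ := by
  obtain ⟨E, rfl⟩ := ModExtension.exists_extClass_eq ξ
  rw [uExt_extClass, ModExtension.u_eq_zero_iff] at hξ
  obtain ⟨N, ⟨i⟩⟩ := S.exists_res_iso E.M hξ
  obtain ⟨f, hf⟩ := S.res.map_surjective (E.f ≫ i.inv)
  obtain ⟨g, hg⟩ := S.res.map_surjective (i.hom ≫ E.g)
  have zero : f ≫ g = 0 := S.res.map_injective (by simp [hf, hg, E.zero])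
  let T := ShortComplex.mk f g zero
  let φ : ShortComplex.mk E.f E.g E.zero ≅ T.map S.res :=
    ShortComplex.isoMk (Iso.refl _) i.symm (Iso.refl _)
      (by change 𝟙 _ ≫ S.res.map f = E.f ≫ i.inv; rw [hf, Category.id_comp])
      (by change i.inv ≫ S.res.map g = E.g ≫ 𝟙 _; rw [hg]; simp)
  have hT' : (T.map S.res).ShortExact := ShortComplex.shortExact_of_iso φ E.shortExact
  have hT : T.ShortExact := ShortExact.reflects_shortExact_of_faithful S.res hT'
  refine ⟨hT.extClass, ?_⟩
  rw [← ModExtension.ofShortExact_extClass hT]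
  have := ShortComplex.ShortExact.extClass_naturality E.shortExact hT' φ.hom
  change E.extClass.comp (Ext.mk₀ (𝟙 _)) _ =
    (Ext.mk₀ (𝟙 _)).comp (ModExtension.ofShortExact hT).extClass _ at this
  rw [Ext.mk₀_id_comp, Ext.comp_mk₀_id] at this
  exact this.symm

/-- Since restriction is fully faithful, an A-linear splitting of a sequence of A₀-modules is
already A₀-linear. -/
lemma resExt_injective (M₀ J : CategoryTheory.Mod D S.A₀) :
    Function.Injective (S.resExt M₀ J 1) := by
  rw [injective_iff_map_eq_zero]
  intro e he
  obtain ⟨M, f, g, zero, h, rfl⟩ := exists_extClass_eq e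
  have h' := h.map_of_exact S.res
  have he' : h'.extClass = 0 := (Ext.mapExactFunctor_extClass S.res h).symm.trans he
  -- As the class is zero, the identity of `J` extends along `f`; the extension `r` is a retraction.
  obtain ⟨r, hr⟩ := Ext.contravariant_sequence_exact₁ h' _ (Ext.mk₀ (𝟙 _)) (add_zero 1)
    (by rw [he', Ext.zero_comp])
  obtain ⟨r, rfl⟩ := (Ext.mk₀_bijective _ _).2 r
  rw [Ext.mk₀_comp_mk₀] at hr
  replace hr : S.res.map f ≫ r = 𝟙 _ := (Ext.mk₀_bijective _ _).1 hr
  obtain ⟨r, rfl⟩ := S.res.map_surjective r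
  replace hr : f ≫ r = 𝟙 _ := S.res.map_injective (by rw [S.res.map_comp, S.res.map_id]; exact hr)
  have := h.extClass_comp_assoc (Ext.mk₀ r) (h := add_zero 1)
  rwa [Ext.mk₀_comp_mk₀, hr, Ext.comp_mk₀_id] at this

lemma resExt_comp_mk₀ {M₀ J J' : CategoryTheory.Mod D S.A₀} (e : Ext.{max w v} M₀ J 1)
    (b : J ⟶ J') :
    S.resExt M₀ J' 1 (e.comp (Ext.mk₀ b) (add_zero 1)) =
      (S.resExt M₀ J 1 e).comp (Ext.mk₀ (S.res.map b)) (add_zero 1) :=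
  (Ext.mapExactFunctor_comp S.res e (Ext.mk₀ b) (add_zero 1)).trans
    (by rw [Ext.mapExactFunctor_mk₀]; rfl)

end SquareZeroExtension

end AlmostDeformation

/-! ### An extension with injective u -/

namespace AlmostDeformation

open CategoryTheory.Abelian

/-- A map out of `X` that kills j ≫ f descends to `Y'` on `Y`, hence to the pushout. Applied to I ⊗
N → N → N/IN and N → P, this identifies the pushout with P/IN. -/
lemma IsPushout.exact_comp {C : Type*} [Category C] [Abelian C] {W X Y Y' M : C} {j : W ⟶ Y}
    {b : Y ⟶ Y'} {zero : j ≫ b = 0} (h : (ShortComplex.mk j b zero).Exact) [Epi b]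
    {f : Y ⟶ X} {φ : X ⟶ M} {f' : Y' ⟶ M} (sq : IsPushout f b φ f')
    (zero' : (j ≫ f) ≫ φ = 0) :
    (ShortComplex.mk (j ≫ f) φ zero').Exact := by
  have : Epi φ := (MorphismProperty.epimorphisms C).of_isPushout sq ‹Epi b›
  refine ShortComplex.exact_of_g_is_cokernel _ (CokernelCofork.IsColimit.ofπ' _ _ (fun k hk => ?_))
  change (j ≫ f) ≫ k = 0 at hk
  rw [Category.assoc] at hk
  exact ⟨sq.desc k (h.desc (f ≫ k) hk) (h.g_desc (f ≫ k) hk).symm, sq.inl_desc _ _ _⟩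

/-- An element of the kernel of `u` lifts to `V`, and its image in `P` comes from `W`. -/
lemma mono_of_exact_comp {C : Type*} [Category C] [Abelian C] {W V P M T K : C} {n : W ⟶ V}
    {m : V ⟶ P} {φ : P ⟶ M} {zero : (n ≫ m) ≫ φ = 0}
    (h : (ShortComplex.mk (n ≫ m) φ zero).Exact) {τ : V ⟶ T} [Epi τ] (hn : n ≫ τ = 0)
    (hm : ∀ {Z : C} (y : Z ⟶ V), y ≫ m = 0 → y ≫ τ = 0) {u : T ⟶ K} {i : K ⟶ M}
    (hu : τ ≫ u ≫ i = m ≫ φ) : Mono u := by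
  refine Preadditive.mono_of_cancel_zero _ (fun z hz => ?_)
  -- After refining, z is the image of y in `V`, and y ≫ m lies in the image of n ≫ m. So y differs
  -- from an element of `W` by something that `m`, hence `τ`, kills; as `τ` also kills `W`, z = 0.
  obtain ⟨Z', e, he, y, hy⟩ := surjective_up_to_refinements_of_epi τ z
  obtain ⟨Z'', e', he', t, ht⟩ := h.exact_up_to_refinements (y ≫ m) (by
    change (y ≫ m) ≫ φ = 0
    rw [Category.assoc, ← hu, ← reassoc_of% hy, reassoc_of% hz, zero_comp, comp_zero])
  change e' ≫ y ≫ m = t ≫ n ≫ m at ht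
  have h0 := hm (e' ≫ y - t ≫ n) (by simp [ht])
  rw [Preadditive.sub_comp, Category.assoc, Category.assoc, hn, comp_zero, sub_zero, ← hy] at h0
  rwa [← cancel_epi e, ← cancel_epi e', comp_zero, comp_zero]

namespace SquareZeroExtension

universe v w

variable {D : Type w} [Category.{v} D] [MonoidalCategory D] [SymmetricCategory D] [Abelian D]
  [MonoidalPreadditive D] [∀ X : D, PreservesFiniteColimits (tensorLeft X)]
  (S : SquareZeroExtension D)

/-- The right multiplication `I ⊗ A ⟶ I`. -/
noncomputable def idealMul : S.I ⊗ S.A ⟶ S.I := S.I ◁ S.p ≫ (β_ S.I S.A₀).hom ≫ S.idealAct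

lemma idealMul_ι : S.idealMul ≫ S.ι = S.ι ▷ S.A ≫ MonObj.mul := by
  rw [idealMul, Category.assoc, Category.assoc, BraidedCategory.braiding_naturality_right_assoc,
    idealAct_spec, ← BraidedCategory.braiding_naturality_left_assoc, IsCommMonObj.mul_comm]

/-- The free `A`-module `A ⊗ X`. -/
abbrev freeMod (X : D) : CategoryTheory.Mod D S.A :=
  mkMod (S.A ⊗ X) ((α_ S.A S.A X).inv ≫ MonObj.mul ▷ X)
    (by rw [associator_inv_naturality_left_assoc, ← comp_whiskerRight, MonObj.one_mul]; simp)
    (by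
      rw [associator_inv_naturality_left_assoc, ← comp_whiskerRight, MonObj.mul_assoc]
      simp)

/-- Multiplication by I on A ⊗ X passes through I ⊗ X. When I ⊗ X → A ⊗ X is mono, its kernel is
thus that of I ⊗ A ⊗ X → I ⊗ X. -/
lemma ι_act_freeMod (X : D) : S.ι ▷ (S.A ⊗ X) ≫ act (S.freeMod X) =
    (α_ S.I S.A X).inv ≫ S.idealMul ▷ X ≫ S.ι ▷ X := by
  rw [← comp_whiskerRight, idealMul_ι]
  change S.ι ▷ (S.A ⊗ X) ≫ (α_ S.A S.A X).inv ≫ MonObj.mul ▷ X = _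
  rw [associator_inv_naturality_left_assoc, comp_whiskerRight]

/-- The `A`-linear map `A ⊗ X ⟶ M` induced by `x : X ⟶ M`. -/
def freeModDesc {X : D} (M : CategoryTheory.Mod D S.A) (x : X ⟶ M.X) : S.freeMod X ⟶ M :=
  mkHom (S.A ◁ x ≫ act M) (by
    change ((α_ S.A S.A X).inv ≫ MonObj.mul ▷ X) ≫ S.A ◁ x ≫ act M =
      S.A ◁ (S.A ◁ x ≫ act M) ≫ act M
    rw [Category.assoc, ← whisker_exchange_assoc, mul_act]
    simp)

instance freeModDesc_epi {X : D} (M : CategoryTheory.Mod D S.A) (x : X ⟶ M.X) [hx : Epi x] :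
    Epi (S.freeModDesc M x) := by
  have h : ((λ_ X).inv ≫ MonObj.one ▷ X) ≫ S.A ◁ x ≫ act M = x := by
    rw [Category.assoc, ← whisker_exchange_assoc, one_act]
    simp
  have : Epi (((λ_ X).inv ≫ MonObj.one ▷ X) ≫ S.A ◁ x ≫ act M) := by rw [h]; infer_instance
  have : Epi ((Mod.forget S.A).map (S.freeModDesc M x)) := epi_of_epi ((λ_ X).inv ≫ MonObj.one ▷ X) (S.A ◁ x ≫ act M)
  exact (Mod.forget S.A).epi_of_epi_map this

/-- The multiplication `I ⊗ N ⟶ N`. -/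
noncomputable def idealSmul (N : CategoryTheory.Mod D S.A) :
    modTensorObj (S.res.obj S.ideal) N.X ⟶ N :=
  mkHom (S.ι ▷ N.X ≫ act N) (by
    change ((α_ S.A S.I N.X).inv ≫ (S.p ▷ S.I ≫ S.idealAct) ▷ N.X) ≫ S.ι ▷ N.X ≫ act N =
      S.A ◁ (S.ι ▷ N.X ≫ act N) ≫ act N
    rw [Category.assoc, ← comp_whiskerRight_assoc, Category.assoc, idealAct_spec,
      comp_whiskerRight_assoc, mul_act]
    simp)

/-- Used for N → N/IN, to make the quotient an A₀-module. -/
lemma ι_act_eq_zero {N K : CategoryTheory.Mod D S.A} (k : N ⟶ K) [Epi k]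
    (hk : S.idealSmul N ≫ k = 0) : S.ι ▷ K.X ≫ act K = 0 := by
  have hk' : (S.ι ▷ N.X ≫ act N) ≫ k.hom = 0 := congrArg Mod.Hom.hom hk
  have : Epi k.hom := inferInstanceAs (Epi ((Mod.forget S.A).map k))
  rw [← cancel_epi (S.I ◁ k.hom), whisker_exchange_assoc, ← act_hom, comp_zero, ← hk',
    Category.assoc]

/-- The composite `I ⊗ (A ⊗ X) ⟶ I ⊗ M₀ ⟶ I ⊗_{A₀} M₀` factors through the multiplication
`I ⊗ A ⟶ I`. -/
lemma whiskerLeft_freeModDesc_modTensorπ {X : D} (M₀ : CategoryTheory.Mod D S.A₀)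
    (x : X ⟶ M₀.X) :
    S.I ◁ (S.freeModDesc (S.res.obj M₀) x).hom ≫ modTensorπ S.ideal M₀ =
      (α_ S.I S.A X).inv ≫ S.idealMul ▷ X ≫ S.I ◁ x ≫ modTensorπ S.ideal M₀ := by
  -- Balancing over A₀ moves a scalar acting on `M₀` to the factor I.
  have h : ((α_ S.I S.A₀ M₀.X).inv ≫ ((β_ S.I S.A₀).hom ≫ S.idealAct) ▷ M₀.X) ≫
      modTensorπ S.ideal M₀ = S.I ◁ act M₀ ≫ modTensorπ S.ideal M₀ :=
    congrArg Mod.Hom.hom (coequalizer.condition (tensorActFst S.ideal M₀) (tensorActSnd S.ideal M₀))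
  change S.I ◁ (S.A ◁ x ≫ S.p ▷ M₀.X ≫ act M₀) ≫ modTensorπ S.ideal M₀ = _
  rw [MonoidalCategory.whiskerLeft_comp, MonoidalCategory.whiskerLeft_comp, Category.assoc,
    Category.assoc, ← h, ← whisker_exchange_assoc, idealMul, comp_whiskerRight]
  simp only [Category.assoc]
  rw [associator_inv_naturality_middle_assoc, associator_inv_naturality_right_assoc,
    comp_whiskerRight_assoc, comp_whiskerRight_assoc]

variable {S} in
/-- If there is an epimorphism `X ⟶ M₀` such that `I ⊗ X ⟶ A ⊗ X` is a monomorphism, then there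
is an extension of `M₀` with injective `u`. -/
lemma exists_extension_mono_u {X : D} [Mono (S.ι ▷ X)] (M₀ : CategoryTheory.Mod D S.A₀)
    (x : X ⟶ M₀.X) [Epi x] :
    ∃ (K : CategoryTheory.Mod D S.A₀) (E : S.ModExtension M₀ K), Mono E.u := by
  let P := S.freeMod X
  let π : P ⟶ S.res.obj M₀ := S.freeModDesc (S.res.obj M₀) x
  let n := kernel.ι π
  have hx : Epi (Y := (S.res.obj M₀).X) x := ‹Epi x›
  have : Epi π := freeModDesc_epi S (S.res.obj M₀) x (hx := hx)
  have hP : (ShortComplex.mk n π (kernel.condition π)).ShortExact :=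
    { exact := ShortComplex.exact_kernel π }
  -- With N the kernel of `π`, the image of `j` is IN; below, `K` is N/IN and the pushout `M` is
  -- P/IN.
  let j := S.idealSmul (kernel π)
  obtain ⟨K, ⟨i⟩⟩ := S.exists_res_iso (cokernel j)
    (S.ι_act_eq_zero (cokernel.π j) (cokernel.condition j))
  let b : kernel π ⟶ S.res.obj K := cokernel.π j ≫ i.inv
  have hjb : j ≫ b = 0 := by simp [b]
  have hb : (ShortComplex.mk j b hjb).Exact :=
    ShortComplex.exact_of_iso (ShortComplex.isoMk (S₁ := ShortComplex.mk j (cokernel.π j)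
      (cokernel.condition j)) (Iso.refl _) (Iso.refl _) i.symm (by simp) (by simp [b]))
      (ShortComplex.exact_cokernel j)
  obtain ⟨M, f, g, zero, φ, h, sq, hg⟩ := exists_shortExact_pushout hP b
  let E : S.ModExtension M₀ K := ⟨M, f, g, zero, h⟩
  refine ⟨K, E, ?_⟩
  have hφ : (j ≫ n) ≫ φ = 0 := by rw [Category.assoc, sq.w, reassoc_of% hjb, zero_comp]
  have hex : (ShortComplex.mk ((S.ι ▷ (kernel π).X ≫ act (kernel π)) ≫ n.hom) φ.hom _).Exact :=
    (IsPushout.exact_comp hb sq hφ).map (Mod.forget S.A)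
  have hmul {N N' : CategoryTheory.Mod D S.A} (t : N ⟶ N') :
      (S.ι ▷ N.X ≫ act N) ≫ t.hom = S.I ◁ t.hom ≫ S.ι ▷ N'.X ≫ act N' := by
    rw [Category.assoc, whisker_exchange_assoc, act_hom]
  simp only [hmul n] at hex
  let π₀ : P.X ⟶ M₀.X := π.hom
  have hπ₀ : Epi π₀ := inferInstanceAs (Epi ((Mod.forget S.A).map π))
  have hnπ : n.hom ≫ π₀ = 0 := congrArg Mod.Hom.hom (kernel.condition π)
  have hπφ : φ.hom ≫ E.q = π₀ := congrArg Mod.Hom.hom hg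
  have hτ : S.I ◁ π₀ ≫ modTensorπ S.ideal M₀ = _ := S.whiskerLeft_freeModDesc_modTensorπ M₀ x
  have : Mono E.u.hom := by
    -- Here W = I ⊗ N, V = I ⊗ P and T = I ⊗_{A₀} M₀.
    refine mono_of_exact_comp (τ := S.I ◁ π₀ ≫ modTensorπ S.ideal M₀) (i := E.i) hex ?_ ?_ ?_
    · rw [← MonoidalCategory.whiskerLeft_comp_assoc, hnπ]
      simp
    -- This is where the monomorphism I ⊗ X → A ⊗ X is needed: an element of I ⊗ P with zero product
    -- already vanishes in I ⊗ X, through which `τ` factors.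
    · intro Z y hy
      rw [S.ι_act_freeMod] at hy
      have h0 : y ≫ (α_ S.I S.A X).inv ≫ S.idealMul ▷ X = 0 := by
        rw [← cancel_mono (S.ι ▷ X)]
        simpa using hy
      rw [hτ]
      simp only [← Category.assoc] at h0 ⊢
      rw [h0, zero_comp, zero_comp]
    · change (S.I ◁ π₀ ≫ modTensorπ S.ideal M₀) ≫ E.u.hom ≫ E.i = _ ≫ (φ.hom : P.X ⟶ E.M.X)
      rw [hmul φ, ← hπφ, Category.assoc, MonoidalCategory.whiskerLeft_comp, Category.assoc,
        ← E.u_spec]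
  have : Mono ((Mod.forget S.A₀).map E.u) := this
  exact (Mod.forget S.A₀).mono_of_mono_map this

end SquareZeroExtension

end AlmostDeformation

/-! ### Connecting maps, obstruction and torsor -/

namespace AlmostDeformation

open CategoryTheory.Abelian

namespace SquareZeroExtension

universe v w

variable {D : Type w} [Category.{v} D] [MonoidalCategory D] [SymmetricCategory D] [Abelian D]
  [MonoidalPreadditive D] [∀ X : D, PreservesFiniteColimits (tensorLeft X)]
  {S : SquareZeroExtension D} {M₀ : CategoryTheory.Mod D S.A₀}

/-- The image of `E` in the third term has u equal to u ≫ T.f ≫ T.g = 0. -/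
lemma exists_resExt_eq_extClass_comp (T : ShortComplex (CategoryTheory.Mod D S.A₀))
    (E : S.ModExtension M₀ T.X₂) {u : modTensor S.ideal M₀ ⟶ T.X₁} (hu : E.u = u ≫ T.f) :
    ∃ e : Ext.{max w v} M₀ T.X₃ 1,
      S.resExt M₀ T.X₃ 1 e = E.extClass.comp (Ext.mk₀ (S.res.map T.g)) (add_zero 1) := by
  apply exists_resExt_eq
  rw [uExt_comp, uExt_extClass, hu, Category.assoc, T.zero, comp_zero]

/-- The image of `e` under the connecting homomorphism of `T` only depends on `u(E)`. -/
lemma connecting_eq_of_u_eq {T : ShortComplex (CategoryTheory.Mod D S.A₀)} (hT : T.ShortExact)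
    {E E' : S.ModExtension M₀ T.X₂} (h : E.u = E'.u) {e e' : Ext.{max w v} M₀ T.X₃ 1}
    (he : S.resExt M₀ T.X₃ 1 e = E.extClass.comp (Ext.mk₀ (S.res.map T.g)) (add_zero 1))
    (he' : S.resExt M₀ T.X₃ 1 e' = E'.extClass.comp (Ext.mk₀ (S.res.map T.g)) (add_zero 1)) :
    e.comp hT.extClass rfl = (e'.comp hT.extClass rfl : Ext.{max w v} M₀ T.X₁ 2) := by
  -- The extensions differ by a class `b` over A₀ with values in `T.X₂`, and the connecting map
  -- kills whatever comes from `T.X₂`.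
  obtain ⟨b, hb⟩ := exists_resExt_eq (E.extClass - E'.extClass) (by
    rw [map_sub, uExt_extClass, uExt_extClass, h, sub_self])
  have hbe : b.comp (Ext.mk₀ T.g) (add_zero 1) = e - e' := by
    apply resExt_injective
    rw [resExt_comp_mk₀, hb, map_sub, he, he', sub_eq_add_neg, Ext.add_comp, Ext.neg_comp,
      ← sub_eq_add_neg]
  obtain rfl : e = b.comp (Ext.mk₀ T.g) (add_zero 1) + e' := by rw [hbe, sub_add_cancel]
  rw [Ext.add_comp, Ext.comp_assoc_of_second_deg_zero, hT.comp_extClass, Ext.comp_zero, zero_add]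

/-- The image of `e` under the connecting homomorphism is natural in `T`. -/
lemma connecting_comp_of_hom {T T' : ShortComplex (CategoryTheory.Mod D S.A₀)}
    (hT : T.ShortExact) (hT' : T'.ShortExact) (φ : T ⟶ T')
    {E : S.ModExtension M₀ T.X₂} {E' : S.ModExtension M₀ T'.X₂} (h : E.u ≫ φ.τ₂ = E'.u)
    {e : Ext.{max w v} M₀ T.X₃ 1} {e' : Ext.{max w v} M₀ T'.X₃ 1}
    (he : S.resExt M₀ T.X₃ 1 e = E.extClass.comp (Ext.mk₀ (S.res.map T.g)) (add_zero 1))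
    (he' : S.resExt M₀ T'.X₃ 1 e' = E'.extClass.comp (Ext.mk₀ (S.res.map T'.g)) (add_zero 1)) :
    (e.comp hT.extClass rfl : Ext.{max w v} M₀ T.X₁ 2).comp (Ext.mk₀ φ.τ₁) (add_zero 2) =
      e'.comp hT'.extClass rfl := by
  -- The pushed extension need not have the class of `E'`, but it has the same u, which suffices by
  -- the previous lemma.
  obtain ⟨E'', hu, hE⟩ := E.exists_pushforward φ.τ₂
  rw [← connecting_eq_of_u_eq hT' (hu.trans h) (e := e.comp (Ext.mk₀ φ.τ₃) (add_zero 1)) (by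
    rw [resExt_comp_mk₀, he, hE, Ext.comp_assoc_of_third_deg_zero,
      Ext.comp_assoc_of_third_deg_zero, Ext.mk₀_comp_mk₀, Ext.mk₀_comp_mk₀, ← S.res.map_comp,
      ← S.res.map_comp, φ.comm₂₃]) he', Ext.comp_assoc_of_third_deg_zero,
    Ext.comp_assoc_of_second_deg_zero, ShortComplex.ShortExact.extClass_naturality hT hT' φ]

/-- The image of `e` under the connecting homomorphism is determined by `u(E)`, viewed as a
morphism to the first term of the short exact sequence. -/
lemma connecting_comp {T T' : ShortComplex (CategoryTheory.Mod D S.A₀)}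
    (hT : T.ShortExact) (hT' : T'.ShortExact) (b : T.X₁ ⟶ T'.X₁)
    {E : S.ModExtension M₀ T.X₂} {E' : S.ModExtension M₀ T'.X₂}
    {u : modTensor S.ideal M₀ ⟶ T.X₁} (h : E.u = u ≫ T.f) (h' : E'.u = (u ≫ b) ≫ T'.f)
    {e : Ext.{max w v} M₀ T.X₃ 1} {e' : Ext.{max w v} M₀ T'.X₃ 1}
    (he : S.resExt M₀ T.X₃ 1 e = E.extClass.comp (Ext.mk₀ (S.res.map T.g)) (add_zero 1))
    (he' : S.resExt M₀ T'.X₃ 1 e' = E'.extClass.comp (Ext.mk₀ (S.res.map T'.g)) (add_zero 1)) :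
    (e.comp hT.extClass rfl : Ext.{max w v} M₀ T.X₁ 2).comp (Ext.mk₀ b) (add_zero 2) =
      e'.comp hT'.extClass rfl := by
  have := hT.mono_f
  have := hT'.mono_f
  have := hT.epi_g
  have := hT'.epi_g
  -- `b` need not extend to a morphism T ⟶ T'. Both sequences map instead to `T''`, which starts
  -- with `T'.X₁` and has this pushout as middle term; the map from T is `b` on first terms, the map
  -- from `T'` the identity. `inr` is mono, being a pushout of `T.f`.
  let inl : T.X₂ ⟶ pushout T.f (b ≫ T'.f) := pushout.inl _ _
  let inr : T'.X₂ ⟶ pushout T.f (b ≫ T'.f) := pushout.inr _ _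
  have w : T.f ≫ inl = (b ≫ T'.f) ≫ inr := pushout.condition
  let f := T'.f ≫ inr
  let T'' := ShortComplex.mk f (cokernel.π f) (cokernel.condition f)
  have hT'' : T''.ShortExact := { exact := ShortComplex.exact_cokernel f }
  have h₁ : T.f ≫ inl ≫ cokernel.π f = 0 := by
    rw [reassoc_of% w, ← Category.assoc T'.f, cokernel.condition, comp_zero]
  have h₂ : T'.f ≫ inr ≫ cokernel.π f = 0 := by
    rw [← Category.assoc T'.f, cokernel.condition]
  let φ : T ⟶ T'' :=
    { τ₁ := b, τ₂ := inl, τ₃ := hT.exact.desc _ h₁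
      comm₁₂ := (w.trans (Category.assoc _ _ _)).symm
      comm₂₃ := (hT.exact.g_desc _ h₁).symm }
  let φ' : T' ⟶ T'' :=
    { τ₁ := 𝟙 _, τ₂ := inr, τ₃ := hT'.exact.desc _ h₂
      comm₁₂ := Category.id_comp _
      comm₂₃ := (hT'.exact.g_desc _ h₂).symm }
  obtain ⟨E'', hE'', -⟩ := E.exists_pushforward inl
  have hE₂ : E'.u ≫ inr = E''.u := by
    rw [hE'', h, h', Category.assoc u T.f, w]
    simp only [Category.assoc]
  obtain ⟨e'', he''⟩ := exists_resExt_eq_extClass_comp T'' E'' (u := u ≫ b) (by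
    rw [← hE₂, h', Category.assoc])
  have k := connecting_comp_of_hom hT hT'' φ hE''.symm he he''
  have k' := connecting_comp_of_hom hT' hT'' φ' hE₂ he' he''
  change _ = _ at k
  have k'' : (e'.comp hT'.extClass rfl : Ext.{max w v} M₀ T'.X₁ 2).comp
    (Ext.mk₀ (𝟙 _)) (add_zero 2) = _ := k'
  rw [Ext.comp_mk₀_id] at k''
  exact k.trans k''.symm

/-- If every object of `D` is a quotient of an object `X` such that `I ⊗ X ⟶ A ⊗ X` is a
monomorphism, then there exist connecting homomorphisms. -/
lemma exists_isConnecting (H : ∀ M : D, ∃ (X : D) (x : X ⟶ M), Epi x ∧ Mono (S.ι ▷ X)) :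
    ∃ d : ∀ M₀ J : CategoryTheory.Mod D S.A₀,
      (modTensor S.ideal M₀ ⟶ J) →+ Ext.{max w v} M₀ J 2, S.IsConnecting d := by
  have h (M₀ : CategoryTheory.Mod D S.A₀) :
      ∃ θ : Ext.{max w v} M₀ (modTensor S.ideal M₀) 2,
        ∀ (T : ShortComplex (CategoryTheory.Mod D S.A₀)) (hT : T.ShortExact)
          (u₀ : modTensor S.ideal M₀ ⟶ T.X₁) (E : S.ModExtension M₀ T.X₂)
          (e : Ext.{max w v} M₀ T.X₃ 1), E.u = u₀ ≫ T.f →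
          S.resExt M₀ T.X₃ 1 e = E.extClass.comp (Ext.mk₀ (S.res.map T.g)) (add_zero 1) →
          θ.comp (Ext.mk₀ u₀) (add_zero 2) = e.comp hT.extClass rfl := by
    obtain ⟨X, x, hx, hX⟩ := H M₀.X
    obtain ⟨K, E, hE⟩ := exists_extension_mono_u M₀ x
    -- The universal case: this sequence computes the obstruction of the identity of I ⊗_{A₀} M₀,
    -- and every other obstruction is its image under `u₀`.
    let T := ShortComplex.mk E.u (cokernel.π E.u) (cokernel.condition E.u)
    have hT : T.ShortExact := { exact := ShortComplex.exact_cokernel E.u }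
    have hu : E.u = 𝟙 _ ≫ T.f := (Category.id_comp _).symm
    obtain ⟨e, he⟩ := exists_resExt_eq_extClass_comp T E hu
    exact ⟨e.comp hT.extClass rfl, fun T' hT' u₀ E' e' h' he' =>
      connecting_comp hT hT' u₀ hu (by rw [h', Category.id_comp]) he he'⟩
  choose θ hθ using h
  exact ⟨fun M₀ J => AddMonoidHom.mk' (fun u₀ => (θ M₀).comp (Ext.mk₀ u₀) (add_zero 2))
    (fun _ _ => by rw [Ext.mk₀_add, Ext.comp_add]), hθ⟩

variable {d : ∀ M₀ J : CategoryTheory.Mod D S.A₀,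
  (modTensor S.ideal M₀ ⟶ J) →+ Ext.{max w v} M₀ J 2}

/-- The connecting property is applied to 0 → J = J → 0 → 0, where e = 0. -/
lemma IsConnecting.eq_zero_of_extension (hd : S.IsConnecting d) {J : CategoryTheory.Mod D S.A₀}
    (E : S.ModExtension M₀ J) : d M₀ J E.u = 0 := by
  have h0 : cokernel.π (𝟙 J) = 0 := (Category.id_comp _).symm.trans (cokernel.condition (𝟙 J))
  have hT : (ShortComplex.mk (𝟙 J) (cokernel.π (𝟙 J)) (cokernel.condition _)).ShortExact :=
    { exact := ShortComplex.exact_cokernel _ }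
  have h1 : E.extClass.comp (Ext.mk₀ (S.res.map (cokernel.π (𝟙 J)))) (add_zero 1) = 0 := by
    rw [h0, S.res.map_zero, Ext.mk₀_zero, Ext.comp_zero]
  have := hd M₀ _ hT E.u E 0 (Category.comp_id _).symm (by rw [map_zero]; exact h1.symm)
  rw [Ext.zero_comp] at this
  exact this

lemma IsConnecting.exists_extension (hd : S.IsConnecting d)
    (H : ∀ M : D, ∃ (X : D) (x : X ⟶ M), Epi x ∧ Mono (S.ι ▷ X)) {J : CategoryTheory.Mod D S.A₀}
    (u₀ : modTensor S.ideal M₀ ⟶ J) (h : d M₀ J u₀ = 0) : ∃ E : S.ModExtension M₀ J, E.u = u₀ := by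
  obtain ⟨X, x, hx, hX⟩ := H M₀.X
  obtain ⟨K, E, hE⟩ := exists_extension_mono_u M₀ x
  have hT : (ShortComplex.mk E.u (cokernel.π E.u) (cokernel.condition E.u)).ShortExact :=
    { exact := ShortComplex.exact_cokernel E.u }
  -- `Q` is a module containing `J` in which `u₀` is realised by an extension; it remains to bring
  -- that extension back to `J`.
  obtain ⟨Q, f, g, zero, φ, hQ, sq, -⟩ := exists_shortExact_pushout hT u₀
  obtain ⟨E', hE', -⟩ := E.exists_pushforward φ
  have hu : E'.u = u₀ ≫ f := hE'.trans sq.w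
  obtain ⟨e, he⟩ := exists_resExt_eq_extClass_comp (ShortComplex.mk f g zero) E' hu
  have hde := hd M₀ _ hQ u₀ E' e hu he
  rw [h] at hde
  -- Vanishing of the obstruction lifts `e` to a class `b` over A₀ in `Q`. Then E' - b has zero
  -- image in the third term, so it comes from `J`.
  obtain ⟨b, rfl⟩ := Ext.covariant_sequence_exact₃ _ hQ e rfl hde.symm
  change Ext.{max w v} M₀ Q 1 at b
  have h0 : (E'.extClass - S.resExt M₀ Q 1 b).comp (Ext.mk₀ (S.res.map g)) (add_zero 1) = 0 := by
    rw [sub_eq_add_neg, Ext.add_comp, Ext.neg_comp, ← resExt_comp_mk₀]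
    exact add_neg_eq_zero.2 he.symm
  obtain ⟨ζ, hζ⟩ := Ext.covariant_sequence_exact₂ _ (hQ.map_of_exact S.res) _ h0
  obtain ⟨E₁, rfl⟩ := ModExtension.exists_extClass_eq ζ
  refine ⟨E₁, ?_⟩
  have : Mono f := hQ.mono_f
  -- Subtracting `b` does not change u, and `f` is mono, so the invariant of `E₁` is `u₀` itself.
  rw [← cancel_mono f, ← hu, ← uExt_extClass, ← uExt_comp]
  refine (congrArg (S.uExt M₀ Q) hζ).trans ?_
  rw [map_sub, uExt_resExt, sub_zero, uExt_extClass]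

namespace ExtensionClasses

variable {J : CategoryTheory.Mod D S.A₀} {u₀ : modTensor S.ideal M₀ ⟶ J}

lemma uExt_extClass (x : S.ExtensionClasses u₀) : S.uExt M₀ J x.extClass = u₀ := by
  obtain ⟨E, rfl⟩ := Quotient.exists_rep x
  exact (SquareZeroExtension.uExt_extClass E.1).trans E.2

lemma extClass_injective :
    Function.Injective (extClass : S.ExtensionClasses u₀ → Ext.{max w v} _ _ 1) := by
  intro x y h
  obtain ⟨E, rfl⟩ := Quotient.exists_rep x
  obtain ⟨E', rfl⟩ := Quotient.exists_rep y
  exact Quotient.sound (ModExtension.exists_iso_of_extClass_eq h)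

lemma exists_extClass_eq (ξ : Ext.{max w v} (S.res.obj M₀) (S.res.obj J) 1)
    (h : S.uExt M₀ J ξ = u₀) : ∃ x : S.ExtensionClasses u₀, x.extClass = ξ := by
  obtain ⟨E, rfl⟩ := ModExtension.exists_extClass_eq ξ
  exact ⟨Quotient.mk _ ⟨E, (SquareZeroExtension.uExt_extClass E).symm.trans h⟩, rfl⟩

/-- The isomorphism classes of extensions with given `u` form a torsor under `Ext¹_{A₀}(M₀, J)`, if
there are any. -/
lemma exists_addTorsor (hne : Nonempty (S.ExtensionClasses u₀)) :
    ∃ _ : AddTorsor (Ext.{max w v} M₀ J 1) (S.ExtensionClasses u₀),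
      ∀ (e : Ext.{max w v} M₀ J 1) (x : S.ExtensionClasses u₀),
        (e +ᵥ x).extClass = S.resExt M₀ J 1 e + x.extClass := by
  -- Adding a class restricted from A₀ preserves u, and conversely two classes with equal u differ
  -- by such a class. The torsor laws are then tested through the injections `extClass` and
  -- `resExt`.
  have hadd (e : Ext.{max w v} M₀ J 1) (x : S.ExtensionClasses u₀) :
      ∃ y : S.ExtensionClasses u₀, y.extClass = S.resExt M₀ J 1 e + x.extClass :=
    exists_extClass_eq _ (by rw [map_add, uExt_resExt, uExt_extClass, zero_add])
  have hsub (x y : S.ExtensionClasses u₀) :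
      ∃ e : Ext.{max w v} M₀ J 1, S.resExt M₀ J 1 e = x.extClass - y.extClass :=
    exists_resExt_eq _ (by rw [map_sub, uExt_extClass, uExt_extClass, sub_self])
  choose add hadd using hadd
  choose sub hsub using hsub
  exact ⟨
    { vadd := add
      zero_vadd x := extClass_injective ((hadd _ _).trans (by rw [map_zero, zero_add]))
      add_vadd e e' x := extClass_injective ((hadd _ _).trans (by
        change _ = extClass (add e (add e' x))
        rw [hadd, hadd, map_add, add_assoc]))
      vsub := sub
      nonempty := hne
      vsub_vadd' x y := extClass_injective ((hadd _ _).trans (by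
        rw [hsub, sub_add_cancel]))
      vadd_vsub' e x := resExt_injective M₀ J (by
        change S.resExt M₀ J 1 (sub (add e x) x) = _
        rw [hsub, hadd, add_sub_cancel_right]) }, hadd⟩

end ExtensionClasses

/-- The deformation theory of modules over a square zero extension `A ⟶ A₀` such that every object
is a quotient of an object `X` for which `I ⊗ X ⟶ A ⊗ X` is a monomorphism. -/
theorem exists_obstruction (H : ∀ M : D, ∃ (X : D) (x : X ⟶ M), Epi x ∧ Mono (S.ι ▷ X)) :
    ∃ d : ∀ M₀ J : CategoryTheory.Mod D S.A₀,
        (modTensor S.ideal M₀ ⟶ J) →+ Ext.{max w v} M₀ J 2,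
      S.IsConnecting d ∧
      ∀ (M₀ J : CategoryTheory.Mod D S.A₀) (u₀ : modTensor S.ideal M₀ ⟶ J),
        (d M₀ J u₀ = 0 ↔ ∃ E : S.ModExtension M₀ J, E.u = u₀) ∧
        (d M₀ J u₀ = 0 →
          ∃ _ : AddTorsor (Ext.{max w v} M₀ J 1) (S.ExtensionClasses u₀),
            ∀ (e : Ext.{max w v} M₀ J 1) (x : S.ExtensionClasses u₀),
              (e +ᵥ x).extClass = S.resExt M₀ J 1 e + x.extClass) := by
  obtain ⟨d, hd⟩ := exists_isConnecting H
  refine ⟨d, hd, fun M₀ J u₀ => ⟨⟨hd.exists_extension H u₀, ?_⟩, fun h => ?_⟩⟩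
  · rintro ⟨E, rfl⟩
    exact hd.eq_zero_of_extension E
  · obtain ⟨E, hE⟩ := hd.exists_extension H u₀ h
    exact ExtensionClasses.exists_addTorsor ⟨Quotient.mk _ ⟨E, hE⟩⟩

end SquareZeroExtension

end AlmostDeformation

/-! ### Enough flat objects, for sheaves and for α-sheaves -/

namespace AlmostDeformation

/-- The tensor isomorphisms of `F` identify this map with the image of f ▷ Z. -/
lemma mono_map_whiskerRight {D D' : Type*} [Category D] [MonoidalCategory D] [Category D']
    [MonoidalCategory D'] (F : D ⥤ D') [F.Monoidal] [F.PreservesMonomorphisms] {X Y : D}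
    (f : X ⟶ Y) (Z : D) [Mono (f ▷ Z)] : Mono (F.map f ▷ F.obj Z) := by
  have h : F.map f ▷ F.obj Z = Functor.LaxMonoidal.μ F X Z ≫ F.map (f ▷ Z) ≫
      inv (Functor.LaxMonoidal.μ F Y Z) := by
    rw [← Functor.LaxMonoidal.μ_natural_left_assoc, IsIso.hom_inv_id, Category.comp_id]
  rw [h]
  infer_instance

section Sheaves

variable {C : Type u} [SmallCategory C] (J : GrothendieckTopology C) (R : Type u) [CommRing R]

lemma mono_whiskerRight_of_flat {M N : ModuleCat.{u} R} (f : M ⟶ N) [Mono f] (P : ModuleCat.{u} R)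
    [Module.Flat R P] : Mono (f ▷ P) := by
  rw [ModuleCat.mono_iff_injective]
  exact Module.Flat.rTensor_preserves_injective_linearMap (M := P) f.hom
    ((ModuleCat.mono_iff_injective f).1 inferInstance)

/-- Every sheaf of modules is a quotient of a sheaf which is flat, being associated with a presheaf
of free modules. -/
lemma exists_epi_mono_whiskerRight {I A : SheafMod C J R} (ι : I ⟶ A) [Mono ι]
    (M : SheafMod C J R) : ∃ (X : SheafMod C J R) (x : X ⟶ M), Epi x ∧ Mono (ι ▷ X) := by
  -- Over each object U this is the free module on the set underlying M(U), and `ε` is the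
  -- tautological surjection. Freeness gives flatness objectwise, and exact monoidal sheafification
  -- carries the resulting monomorphism to sheaves.
  let F : Cᵒᵖ ⥤ ModuleCat.{u} R :=
    (toPresheaf J R).obj M ⋙ forget (ModuleCat.{u} R) ⋙ ModuleCat.free R
  let ε : F ⟶ (toPresheaf J R).obj M :=
    Functor.whiskerLeft ((toPresheaf J R).obj M) (ModuleCat.adj R).counit
  have hε : Epi ε := by
    have (U : Cᵒᵖ) : Epi (ε.app U) :=
      inferInstanceAs (Epi ((ModuleCat.adj R).counit.app _))
    exact NatTrans.epi_of_epi_app ε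
  have : (sheafify J R).IsLeftAdjoint := (sheafifyAdj J R).isLeftAdjoint
  have : (toPresheaf J R).IsRightAdjoint := (sheafifyAdj J R).isRightAdjoint
  have : PreservesFiniteLimits (sheafify J R) :=
    inferInstanceAs (PreservesFiniteLimits (presheafToSheaf J (ModuleCat.{u} R)))
  refine ⟨(sheafify J R).obj F, (sheafify J R).map ε ≫ (sheafifyAdj J R).counit.app M,
    inferInstance, ?_⟩
  let f := (toPresheaf J R).map ι
  have : Mono (f ▷ F) := by
    have (U : Cᵒᵖ) : Mono ((f ▷ F).app U) := by
      have : Module.Flat R (F.obj U) :=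
        inferInstanceAs (Module.Flat R (((toPresheaf J R).obj M).obj U →₀ R))
      exact mono_whiskerRight_of_flat R (f.app U) (F.obj U)
    exact NatTrans.mono_of_mono_app _
  have := mono_map_whiskerRight (sheafify J R) f F
  -- Up to the counit isomorphisms, `ι` is the sheafification of its underlying map of presheaves.
  have h : ι = inv ((sheafifyAdj J R).counit.app I) ≫ (sheafify J R).map f ≫
      (sheafifyAdj J R).counit.app A := by
    rw [IsIso.eq_inv_comp]
    exact ((sheafifyAdj J R).counit.naturality ι).symm
  rw [h, comp_whiskerRight, comp_whiskerRight]
  infer_instance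

end Sheaves

section Almost

universe v w

variable {R : Type u} [CommRing R] (m : Ideal R) {D : Type w} [Category.{v} D] [Abelian D]
  [Linear R D] [MonoidalCategory D] [SymmetricCategory D] [MonoidalPreadditive D]
  [MonoidalLinear R D] [∀ X : D, PreservesFiniteColimits (tensorLeft X)]
  [Fact (IsIdempotentElem m)]

/-- Every α-object comes from an object of `D`, and the exact monoidal quotient functor preserves
both the epimorphism and the monomorphism chosen there. -/
lemma exists_epi_mono_whiskerRight_alpha {I A : D} (ι : I ⟶ A)
    (H : ∀ M : D, ∃ (X : D) (x : X ⟶ M), Epi x ∧ Mono (ι ▷ X)) (M : Alpha m D) :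
    ∃ (X : Alpha m D) (x : X ⟶ M), Epi x ∧ Mono ((toAlpha m D).map ι ▷ X) := by
  have : (toAlpha m D).EssSurj := Localization.essSurj (toAlpha m D) (alphaIso m D)
  obtain ⟨X, x, hx, hX⟩ := H ((toAlpha m D).objPreimage M)
  exact ⟨(toAlpha m D).obj X, (toAlpha m D).map x ≫ ((toAlpha m D).objObjPreimageIso M).hom,
    inferInstance, mono_map_whiskerRight (toAlpha m D) ι X⟩

end Almost

end AlmostDeformation

theorem mainTheorem9 (p : ℕ) [Fact p.Prime]
    {OK K Kbar : Type u}
    [CommRing OK] [IsDomain OK] [IsDiscreteValuationRing OK]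
    [IsAdicComplete (IsLocalRing.maximalIdeal OK) OK]
    [Field K] [CharZero K] [Algebra OK K] [IsFractionRing OK K]
    [Algebra (ZMod p) (IsLocalRing.ResidueField OK)]
    [IsAlgClosure (ZMod p) (IsLocalRing.ResidueField OK)]
    [Field Kbar] [Algebra K Kbar] [Algebra OK Kbar] [IsScalarTower OK K Kbar]
    [IsAlgClosed Kbar] [Algebra.IsAlgebraic K Kbar]
    (m : Ideal (CompletedIntegers p OK Kbar)) [m.IsMaximal]
    {C : Type u} [SmallCategory C] (T : GrothendieckTopology C)
    (S : SquareZeroExtension (SheafMod C T (CompletedIntegers p OK Kbar))) :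
    ∃ d : ∀ M₀ J : CategoryTheory.Mod
          (Alpha m (SheafMod C T (CompletedIntegers p OK Kbar))) (S.alpha m).A₀,
        (modTensor (S.alpha m).ideal M₀ ⟶ J) →+ Abelian.Ext.{u + 1} M₀ J 2,
      (S.alpha m).IsConnecting d ∧
      ∀ (M₀ J : CategoryTheory.Mod
          (Alpha m (SheafMod C T (CompletedIntegers p OK Kbar))) (S.alpha m).A₀)
        (u₀ : modTensor (S.alpha m).ideal M₀ ⟶ J),
        (d M₀ J u₀ = 0 ↔ ∃ E : (S.alpha m).ModExtension M₀ J, E.u = u₀) ∧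
        (d M₀ J u₀ = 0 →
          ∃ _ : AddTorsor (Abelian.Ext.{u + 1} M₀ J 1) ((S.alpha m).ExtensionClasses u₀),
            ∀ (e : Abelian.Ext.{u + 1} M₀ J 1) (x : (S.alpha m).ExtensionClasses u₀),
              (e +ᵥ x).extClass = (S.alpha m).resExt M₀ J 1 e + x.extClass) :=
  SquareZeroExtension.exists_obstruction (S := S.alpha m)
    (exists_epi_mono_whiskerRight_alpha m S.ι (exists_epi_mono_whiskerRight T _ S.ι))
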